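/- Let $X$ be a smooth $n$-dimensional manifold (Hausdorff, $\sigma$-compact, without boundary), $\alpha$ a smooth real vector bundle of finite rank over $X$, $\Lambda^i_X$ the bundle of differential $i$-forms and $\hat\alpha=\mathrm{Hom}(\alpha,\Lambda^n_X)$ the conjugate bundle, with pairing $\langle\cdot,\cdot\rangle:\Gamma(\hat\alpha)\times\Gamma(\alpha)\to\Omega^n(X)$. For a vector bundle $\beta$ an $l$-linear differential operator from $\alpha$ to $\beta$ is an $\mathbb R$-multilinear map $\Gamma(\alpha)^l\to\Gamma(\beta)$ that is a linear differential operator in each argument, of order bounded independently of the other arguments; $\mathrm{Sym}^l\mathcal D(\alpha,\beta)$ denotes the space of those that are symmetric. Call an $l$-linear differential operator with values in $\Lambda^i_X$ exact if it is $0$ (when $i=0$), respectively of the form $d\circ G$ with $G$ an $l$-linear differential operator with values in $\Lambda^{i-1}_X$ (when $i>0$); no symmetry of $G$ is required. A linear differential operator $\Delta:\Gamma(\alpha)\to\Gamma(\hat\alpha)$ is formally self-adjoint if $\langle\Delta s,t\rangle-\langle\Delta t,s\rangle=E(s,t)$ for all $s,t\in\Gamma(\alpha)$, with $E$ an exact bilinear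 differential operator (Green's formula). Let $\mathrm{Sym}^{m}_{\mathrm{self}}\mathcal D(\alpha,\hat\alpha)$ be the space of $m$-linear symmetric differential operators from $\alpha$ to $\hat\alpha$ that are formally self-adjoint in each argument when the others are fixed (for $m=0$ this is $\Gamma(\hat\alpha)$). Let $l>0$ and consider the complex $\mathrm{Sym}^l\mathcal D(\alpha,\Lambda^0_X)\to\mathrm{Sym}^l\mathcal D(\alpha,\Lambda^1_X)\to\cdots\to\mathrm{Sym}^l\mathcal D(\alpha,\Lambda^n_X)\to 0$ with differential $d_{\mathrm{DR}}:\Delta\mapsto d\circ\Delta$ given by left composition with the de Rham differential. Then: (1) $H^i\big(\mathrm{Sym}^l\mathcal D(\alpha,\Lambda^\bullet_X),d_{\mathrm{DR}}\big)=0$ for all $0\le i<n$. (2) There is an $\mathbb R$-linear isomorphism $\Phi:H^n\big(\mathrm{Sym}^l\mathcal D(\alpha,\Lambda^\bullet_X),d_{\mathrm{DR}}\big)\to\mathrm{Sym}^{l-1}_{\mathrm{self}}\mathcal D(\alpha,\hat\alpha)$ such that for every $\Delta\in\mathrm{Sym}^l\mathcal D(\alpha,\Lambda^n_X)$ the difference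 $\Delta(s_1,\dots,s_l)-\langle\Phi[\Delta](s_1,\dots,s_{l-1}),s_l\rangle$ is an exact $l$-linear differential operator. (3) In particular, for $l=1$, there is an isomorphism $\Psi:H^n\big(\mathcal D(\alpha,\Lambda^\bullet_X),d_{\mathrm{DR}}\big)\to\Gamma(\hat\alpha)$ such that $\Delta(s)-\langle\Psi[\Delta],s\rangle$ is an exact linear differential operator for every $\Delta$; it is $C^\infty(X)$-linear, where $f\in C^\infty(X)$ acts on operators by right composition, $\Delta\mapsto\Delta\circ f$. -/

import Mathlib

open scoped Manifold ContDiff Bundle Topology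

noncomputable section

namespace DiffOpCohomology

/-! ### Differential operators between modules over a commutative algebra -/

section Algebra

variable {A : Type*} [CommRing A] [Algebra ℝ A]
  {P : Type*} [AddCommGroup P] [Module ℝ P] [Module A P] [IsScalarTower ℝ A P]
  {Q : Type*} [AddCommGroup Q] [Module ℝ Q] [Module A Q] [IsScalarTower ℝ A Q]
  {R : Type*} [AddCommGroup R] [Module ℝ R] [Module A R] [IsScalarTower ℝ A R]

/-- The commutator `[Δ, f] : p ↦ Δ (f p) - f Δ(p)` of an `ℝ`-linear map with the multiplication
by `f`. -/
def commutator (Δ : P →ₗ[ℝ] Q) (f : A) : P →ₗ[ℝ] Q :=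
  Δ ∘ₗ Algebra.lsmul ℝ ℝ P f - Algebra.lsmul ℝ ℝ Q f ∘ₗ Δ

@[simp] theorem commutator_apply (Δ : P →ₗ[ℝ] Q) (f : A) (p : P) :
    commutator Δ f p = Δ (f • p) - f • Δ p := rfl

variable (A) in
/-- `HasOrderLT A k Δ`: the `ℝ`-linear map `Δ` between two `A`-modules is a linear differential
operator of order `< k`, that is, all its `k`-fold iterated commutators
`[...[[Δ, f₁], f₂], ..., fₖ]` with elements of `A` vanish. -/
def HasOrderLT : ℕ → (P →ₗ[ℝ] Q) → Prop
  | 0, Δ => Δ = 0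
  | k + 1, Δ => ∀ f : A, HasOrderLT k (commutator Δ f)

theorem HasOrderLT.zero (k : ℕ) : HasOrderLT A k (0 : P →ₗ[ℝ] Q) := by
  induction k with
  | zero => rfl
  | succ k ih =>
    intro f
    have : commutator (0 : P →ₗ[ℝ] Q) f = 0 := by ext; simp
    rw [this]; exact ih

theorem HasOrderLT.succ {k : ℕ} : ∀ {Δ : P →ₗ[ℝ] Q}, HasOrderLT A k Δ → HasOrderLT A (k + 1) Δ := by
  induction k with
  | zero => intro Δ h; rw [show Δ = 0 from h]; exact HasOrderLT.zero _
  | succ k ih => intro Δ h f; exact ih (h f)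

theorem HasOrderLT.mono {k m : ℕ} (hkm : k ≤ m) {Δ : P →ₗ[ℝ] Q} (h : HasOrderLT A k Δ) :
    HasOrderLT A m Δ := by
  induction m, hkm using Nat.le_induction with
  | base => exact h
  | succ m _ ih => exact ih.succ

theorem HasOrderLT.add {k : ℕ} : ∀ {Δ Δ' : P →ₗ[ℝ] Q}, HasOrderLT A k Δ → HasOrderLT A k Δ' →
    HasOrderLT A k (Δ + Δ') := by
  induction k with
  | zero =>
    intro Δ Δ' h h'
    rw [show Δ = 0 from h, show Δ' = 0 from h', add_zero]; rfl
  | succ k ih =>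
    intro Δ Δ' h h' f
    have : commutator (Δ + Δ') f = commutator Δ f + commutator Δ' f := by
      ext p; simp only [commutator_apply, LinearMap.add_apply, smul_add]; abel
    rw [this]; exact ih (h f) (h' f)

theorem HasOrderLT.smul (c : ℝ) {k : ℕ} : ∀ {Δ : P →ₗ[ℝ] Q}, HasOrderLT A k Δ →
    HasOrderLT A k (c • Δ) := by
  induction k with
  | zero => intro Δ h; rw [show Δ = 0 from h, smul_zero]; rfl
  | succ k ih =>
    intro Δ h f
    have : commutator (c • Δ) f = c • commutator Δ f := by
      ext p
      have := smul_algebra_smul_comm c f (Δ p)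
      simp only [commutator_apply, LinearMap.smul_apply, smul_sub, this]
    rw [this]; exact ih (h f)

/-- The composite of two differential operators is a differential operator. -/
theorem HasOrderLT.comp {a b : ℕ} {D : Q →ₗ[ℝ] R} {Δ : P →ₗ[ℝ] Q}
    (hD : HasOrderLT A a D) (hΔ : HasOrderLT A b Δ) : HasOrderLT A (a + b) (D ∘ₗ Δ) := by
  induction hN : a + b generalizing a b D Δ with
  | zero =>
    obtain ⟨rfl, rfl⟩ : a = 0 ∧ b = 0 := by omega
    rw [show D = 0 from hD, LinearMap.zero_comp]; rfl
  | succ N ih =>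
    rcases a with _ | a
    · rw [show D = 0 from hD, LinearMap.zero_comp]; exact HasOrderLT.zero _
    rcases b with _ | b
    · rw [show Δ = 0 from hΔ, LinearMap.comp_zero]; exact HasOrderLT.zero _
    intro f
    have : commutator (D ∘ₗ Δ) f = commutator D f ∘ₗ Δ + D ∘ₗ commutator Δ f := by
      ext p; simp
    rw [this]
    exact (ih (hD f) hΔ (by omega)).add (ih hD (hΔ f) (by omega))

theorem toLinearMap_zero {l : ℕ} (s : Fin l → P) (i : Fin l) :
    (0 : MultilinearMap ℝ (fun _ : Fin l => P) Q).toLinearMap s i = 0 := rfl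

theorem toLinearMap_add {l : ℕ} (D D' : MultilinearMap ℝ (fun _ : Fin l => P) Q)
    (s : Fin l → P) (i : Fin l) :
    (D + D').toLinearMap s i = D.toLinearMap s i + D'.toLinearMap s i := rfl

theorem toLinearMap_smul {l : ℕ} (c : ℝ) (D : MultilinearMap ℝ (fun _ : Fin l => P) Q)
    (s : Fin l → P) (i : Fin l) :
    (c • D).toLinearMap s i = c • D.toLinearMap s i := rfl

variable (A P Q) in
/-- The `l`-linear differential operators from `P` to `Q`: the `ℝ`-multilinear maps
`P × ⋯ × P → Q` which are linear differential operators in each argument, of an order that is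
bounded independently of the other arguments. -/
def multiDiffOp (l : ℕ) : Submodule ℝ (MultilinearMap ℝ (fun _ : Fin l => P) Q) where
  carrier := {Δ | ∃ k, ∀ (s : Fin l → P) (i : Fin l), HasOrderLT A k (Δ.toLinearMap s i)}
  zero_mem' := ⟨0, fun _ _ => rfl⟩
  add_mem' := by
    rintro Δ Δ' ⟨k, hk⟩ ⟨k', hk'⟩
    exact ⟨max k k', fun s i =>
      ((hk s i).mono (le_max_left _ _)).add ((hk' s i).mono (le_max_right _ _))⟩
  smul_mem' := by
    rintro c Δ ⟨k, hk⟩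
    exact ⟨k, fun s i => (hk s i).smul c⟩

variable (A P Q) in
/-- `Sym^l D(P, Q)`: the `l`-linear differential operators that are symmetric in their
arguments. -/
def symDiffOp (l : ℕ) : Submodule ℝ (MultilinearMap ℝ (fun _ : Fin l => P) Q) where
  carrier := {Δ | Δ ∈ multiDiffOp A P Q l ∧
    ∀ (σ : Equiv.Perm (Fin l)) (s : Fin l → P), Δ (s ∘ σ) = Δ s}
  zero_mem' := ⟨zero_mem _, fun _ _ => rfl⟩
  add_mem' := by
    rintro Δ Δ' ⟨h, hs⟩ ⟨h', hs'⟩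
    exact ⟨add_mem h h', fun σ s => by simp [hs σ s, hs' σ s]⟩
  smul_mem' := by
    rintro c Δ ⟨h, hs⟩
    exact ⟨Submodule.smul_mem _ c h, fun σ s => by simp [hs σ s]⟩

variable (A P Q) in
/-- The space `Sym^l D(P, Q)` of `l`-linear symmetric differential operators, as a type. -/
def SymDiffOp (l : ℕ) : Type _ := symDiffOp A P Q l

instance (l : ℕ) : AddCommGroup (SymDiffOp A P Q l) :=
  inferInstanceAs (AddCommGroup (symDiffOp A P Q l))

instance (l : ℕ) : Module ℝ (SymDiffOp A P Q l) :=
  inferInstanceAs (Module ℝ (symDiffOp A P Q l))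

theorem comp_mem_multiDiffOp {D : Q →ₗ[ℝ] R} {a : ℕ} (hD : HasOrderLT A a D) {l : ℕ}
    {Δ : MultilinearMap ℝ (fun _ : Fin l => P) Q} (hΔ : Δ ∈ multiDiffOp A P Q l) :
    D.compMultilinearMap Δ ∈ multiDiffOp A P R l := by
  obtain ⟨k, hk⟩ := hΔ
  exact ⟨a + k, fun s i => hD.comp (hk s i)⟩

theorem comp_mem_symDiffOp {D : Q →ₗ[ℝ] R} {a : ℕ} (hD : HasOrderLT A a D) {l : ℕ}
    {Δ : MultilinearMap ℝ (fun _ : Fin l => P) Q} (hΔ : Δ ∈ symDiffOp A P Q l) :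
    D.compMultilinearMap Δ ∈ symDiffOp A P R l :=
  ⟨comp_mem_multiDiffOp hD hΔ.1, fun σ s => by simp [hΔ.2 σ s]⟩

end Algebra

end DiffOpCohomology

namespace DiffOpCohomology

/-! ### Differential forms and the de Rham differential on a smooth manifold -/

section Forms

/-- The model space `ℝⁿ`. -/
abbrev Model (n : ℕ) : Type := EuclideanSpace ℝ (Fin n)

variable {n : ℕ} {X : Type*} [TopologicalSpace X] [ChartedSpace (Model n) X]

variable (n) in
/-- The fibre at `x` of the bundle `Λ^k_X`: alternating `k`-linear forms on the tangent space. -/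
abbrev FormAt (k : ℕ) (x : X) : Type := TangentSpace (𝓡 n) x [⋀^Fin k]→L[ℝ] ℝ

/-- The expression of a `k`-form in the chart at `x₀`: its pullback to `ℝⁿ` under the inverse of
the chart. -/
def chartRep {k : ℕ} (η : ∀ x : X, FormAt n k x) (x₀ : X) (y : Model n) :
    Model n [⋀^Fin k]→L[ℝ] ℝ :=
  (η ((extChartAt (𝓡 n) x₀).symm y)).compContinuousLinearMap
    (mfderiv 𝓘(ℝ, Model n) (𝓡 n) (extChartAt (𝓡 n) x₀).symm y)

/-- The exterior derivative of a `k`-form, computed at `x` in the chart at `x`. -/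
def extDerivForm {k : ℕ} (η : ∀ x : X, FormAt n k x) (x : X) : FormAt n (k + 1) x :=
  (extDeriv (chartRep η x) (extChartAt (𝓡 n) x x)).compContinuousLinearMap
    (mfderiv (𝓡 n) 𝓘(ℝ, Model n) (extChartAt (𝓡 n) x) x)

variable (n X) in
/-- The `k`-forms on `X` whose expressions in the charts are `C^∞`. -/
def smoothForms (k : ℕ) : Submodule ℝ (∀ x : X, FormAt n k x) where
  carrier := {η | ∀ x₀ : X, ContDiffOn ℝ ∞ (chartRep η x₀) (extChartAt (𝓡 n) x₀).target}
  zero_mem' := fun _ => contDiffOn_const (c := 0)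
  add_mem' := fun h h' x₀ => (h x₀).add (h' x₀)
  smul_mem' := fun c _ h x₀ => (h x₀).const_smul c

variable (n X) in
/-- `Ω^k(X)`: the space of smooth differential `k`-forms on `X`. -/
def DiffForm (k : ℕ) : Type _ := smoothForms n X k

instance (k : ℕ) : AddCommGroup (DiffForm n X k) := inferInstanceAs (AddCommGroup (smoothForms n X k))

instance (k : ℕ) : Module ℝ (DiffForm n X k) := inferInstanceAs (Module ℝ (smoothForms n X k))

/-- Smooth real functions on `X`. -/
abbrev SmoothFun (n : ℕ) (X : Type*) [TopologicalSpace X] [ChartedSpace (Model n) X] : Type _ :=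
  C^∞⟮𝓡 n, X; ℝ⟯

theorem chartRep_smul {k : ℕ} (f : X → ℝ) (η : ∀ x : X, FormAt n k x) (x₀ : X) :
    chartRep (fun x => f x • η x) x₀ =
      fun y => f ((extChartAt (𝓡 n) x₀).symm y) • chartRep η x₀ y := rfl

theorem contDiffOn_comp_chart [IsManifold (𝓡 n) ∞ X] (f : SmoothFun n X) (x₀ : X) :
    ContDiffOn ℝ ∞ (fun y => f ((extChartAt (𝓡 n) x₀).symm y)) (extChartAt (𝓡 n) x₀).target := by
  rw [← contMDiffOn_iff_contDiffOn]
  exact f.contMDiff.comp_contMDiffOn (contMDiffOn_extChartAt_symm x₀)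

instance [IsManifold (𝓡 n) ∞ X] (k : ℕ) : Module (SmoothFun n X) (DiffForm n X k) where
  smul f η := ⟨fun x => f x • η.1 x, fun x₀ => by
    rw [chartRep_smul]
    exact (contDiffOn_comp_chart f x₀).smul (η.2 x₀)⟩
  one_smul η := Subtype.ext (funext fun x => one_smul ℝ (η.1 x))
  mul_smul f g η := Subtype.ext (funext fun x => mul_smul (f x) (g x) (η.1 x))
  smul_zero f := Subtype.ext (funext fun x => smul_zero (f x))
  smul_add f η θ := Subtype.ext (funext fun x => smul_add (f x) (η.1 x) (θ.1 x))
  add_smul f g η := Subtype.ext (funext fun x => add_smul (f x) (g x) (η.1 x))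
  zero_smul η := Subtype.ext (funext fun x => zero_smul ℝ (η.1 x))

theorem DiffForm.smul_apply [IsManifold (𝓡 n) ∞ X] {k : ℕ} (f : (SmoothFun n X))
    (η : DiffForm n X k) (x : X) : (f • η).1 x = f x • η.1 x := rfl

instance [IsManifold (𝓡 n) ∞ X] (k : ℕ) : IsScalarTower ℝ (SmoothFun n X) (DiffForm n X k) where
  smul_assoc c f η := Subtype.ext (funext fun x => smul_assoc c (f x) (η.1 x))

theorem two_le_smooth : minSmoothness ℝ 2 ≤ ∞ := by
  rw [minSmoothness_of_isRCLikeNormedField]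
  exact WithTop.coe_le_coe.2 (le_top (a := (2 : ℕ∞)))

theorem mfderiv_extChartAt_symm_comp [IsManifold (𝓡 n) ∞ X] (x₀ x₁ : X)
    {y : Model n} (hy : y ∈ (extChartAt (𝓡 n) x₀).target)
    (hy' : (extChartAt (𝓡 n) x₀).symm y ∈ (extChartAt (𝓡 n) x₁).source) :
    ContDiffAt ℝ ∞ (extChartAt (𝓡 n) x₁ ∘ (extChartAt (𝓡 n) x₀).symm) y ∧
    ∀ v : Model n, mfderiv 𝓘(ℝ, Model n) (𝓡 n) (extChartAt (𝓡 n) x₀).symm y v =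
      mfderiv 𝓘(ℝ, Model n) (𝓡 n) (extChartAt (𝓡 n) x₁).symm
        (extChartAt (𝓡 n) x₁ ((extChartAt (𝓡 n) x₀).symm y))
        (fderiv ℝ (extChartAt (𝓡 n) x₁ ∘ (extChartAt (𝓡 n) x₀).symm) y v) := by
  have h0 : ContMDiffAt 𝓘(ℝ, Model n) (𝓡 n) ∞ (extChartAt (𝓡 n) x₀).symm y :=
    (contMDiffOn_extChartAt_symm x₀).contMDiffAt ((isOpen_extChartAt_target x₀).mem_nhds hy)
  have h1 : ContMDiffAt (𝓡 n) 𝓘(ℝ, Model n) ∞ (extChartAt (𝓡 n) x₁)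
      ((extChartAt (𝓡 n) x₀).symm y) :=
    contMDiffAt_extChartAt' (by simpa using hy')
  have h2 : ContMDiffAt 𝓘(ℝ, Model n) 𝓘(ℝ, Model n) ∞
      (extChartAt (𝓡 n) x₁ ∘ (extChartAt (𝓡 n) x₀).symm) y := h1.comp y h0
  have hz := (extChartAt (𝓡 n) x₁).map_source hy'
  have h3 : ContMDiffAt 𝓘(ℝ, Model n) (𝓡 n) ∞ (extChartAt (𝓡 n) x₁).symm
      (extChartAt (𝓡 n) x₁ ((extChartAt (𝓡 n) x₀).symm y)) :=
    (contMDiffOn_extChartAt_symm x₁).contMDiffAt ((isOpen_extChartAt_target x₁).mem_nhds hz)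
  refine ⟨contMDiffAt_iff_contDiffAt.1 h2, fun v => ?_⟩
  have he : (extChartAt (𝓡 n) x₀).symm =ᶠ[𝓝 y]
      (extChartAt (𝓡 n) x₁).symm ∘ (extChartAt (𝓡 n) x₁ ∘ (extChartAt (𝓡 n) x₀).symm) := by
    have := h0.continuousAt.preimage_mem_nhds ((isOpen_extChartAt_source x₁).mem_nhds hy')
    filter_upwards [this] with z hz
    exact ((extChartAt (𝓡 n) x₁).left_inv hz).symm
  rw [he.mfderiv_eq, mfderiv_comp y
    (h3.mdifferentiableAt (by simp)) (h2.mdifferentiableAt (by simp)), mfderiv_eq_fderiv]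
  rfl

/-- Change of charts for the expression of a form. -/
theorem chartRep_change [IsManifold (𝓡 n) ∞ X] {k : ℕ} (η : ∀ x : X, FormAt n k x) (x₀ x₁ : X)
    {y : Model n} (hy : y ∈ (extChartAt (𝓡 n) x₀).target)
    (hy' : (extChartAt (𝓡 n) x₀).symm y ∈ (extChartAt (𝓡 n) x₁).source) :
    chartRep η x₀ y = (chartRep η x₁ (extChartAt (𝓡 n) x₁ ((extChartAt (𝓡 n) x₀).symm y))
      ).compContinuousLinearMap
        (fderiv ℝ (extChartAt (𝓡 n) x₁ ∘ (extChartAt (𝓡 n) x₀).symm) y) := by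
  ext v
  let η' : X → Model n [⋀^Fin k]→L[ℝ] ℝ := η
  have hl := (extChartAt (𝓡 n) x₁).left_inv hy'
  have h2 := (mfderiv_extChartAt_symm_comp x₀ x₁ hy hy').2
  change η' _ _ = η' _ _
  rw [hl]
  congr 1
  funext i
  exact h2 (v i)

/-- In every chart, the exterior derivative is the one of `ℝⁿ`. -/
theorem chartRep_extDerivForm [IsManifold (𝓡 n) ∞ X] {k : ℕ} (η : DiffForm n X k) (x₀ : X)
    {y : Model n} (hy : y ∈ (extChartAt (𝓡 n) x₀).target) :
    chartRep (extDerivForm η.1) x₀ y = extDeriv (chartRep η.1 x₀) y := by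
  set x := (extChartAt (𝓡 n) x₀).symm y with hx
  have hxs : x ∈ (extChartAt (𝓡 n) x).source := mem_extChartAt_source x
  have hc := (mfderiv_extChartAt_symm_comp x₀ x hy hxs).1
  have hev : chartRep η.1 x₀ =ᶠ[𝓝 y] fun z =>
      (chartRep η.1 x ((extChartAt (𝓡 n) x ∘ (extChartAt (𝓡 n) x₀).symm) z)
        ).compContinuousLinearMap
        (fderiv ℝ (extChartAt (𝓡 n) x ∘ (extChartAt (𝓡 n) x₀).symm) z) := by
    have h0 : ContinuousAt (extChartAt (𝓡 n) x₀).symm y := continuousAt_extChartAt_symm'' hy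
    filter_upwards [(isOpen_extChartAt_target x₀).mem_nhds hy,
      h0.preimage_mem_nhds ((isOpen_extChartAt_source x).mem_nhds hxs)] with z hz hz'
    exact chartRep_change η.1 x₀ x hz hz'
  have hd : DifferentiableAt ℝ (chartRep η.1 x)
      ((extChartAt (𝓡 n) x ∘ (extChartAt (𝓡 n) x₀).symm) y) :=
    ((η.2 x).contDiffAt ((isOpen_extChartAt_target x).mem_nhds
      ((extChartAt (𝓡 n) x).map_source hxs))).differentiableAt (by simp)
  rw [hev.extDeriv_eq, extDeriv_pullback hd hc two_le_smooth]
  ext v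
  have h0 : MDifferentiableAt 𝓘(ℝ, Model n) (𝓡 n) (extChartAt (𝓡 n) x₀).symm y :=
    ((contMDiffOn_extChartAt_symm (n := ∞) x₀).contMDiffAt
      ((isOpen_extChartAt_target x₀).mem_nhds hy)).mdifferentiableAt (by simp)
  have h1 : MDifferentiableAt (𝓡 n) 𝓘(ℝ, Model n) (extChartAt (𝓡 n) x)
      ((extChartAt (𝓡 n) x₀).symm y) :=
    (contMDiffAt_extChartAt (n := ∞) (x := x)).mdifferentiableAt (by simp)
  have hcomp := mfderiv_comp y h1 h0
  rw [mfderiv_eq_fderiv] at hcomp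
  rw [hcomp]
  rfl

theorem DiffForm.differentiableAt {k : ℕ} (η : DiffForm n X k) (x : X) :
    DifferentiableAt ℝ (chartRep η.1 x) (extChartAt (𝓡 n) x x) :=
  ((η.2 x).contDiffAt ((isOpen_extChartAt_target x).mem_nhds
    (mem_extChartAt_target x))).differentiableAt (by simp)

variable (n X) in
/-- The de Rham differential `Ω^k(X) → Ω^{k+1}(X)`. -/
def deRham [IsManifold (𝓡 n) ∞ X] (k : ℕ) : DiffForm n X k →ₗ[ℝ] DiffForm n X (k + 1) where
  toFun η := ⟨extDerivForm η.1, fun x₀ => by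
    have h : ContDiffOn ℝ ∞ (extDeriv (chartRep η.1 x₀)) (extChartAt (𝓡 n) x₀).target :=
      (ContinuousAlternatingMap.alternatizeUncurryFinCLM ℝ (Model n) ℝ).contDiff.comp_contDiffOn
        ((η.2 x₀).fderiv_of_isOpen (isOpen_extChartAt_target x₀) (by simp))
    exact h.congr fun y hy => chartRep_extDerivForm η x₀ hy⟩
  map_add' η θ := Subtype.ext <| funext fun x => by
    have h := extDeriv_add (DiffForm.differentiableAt η x) (DiffForm.differentiableAt θ x)
    exact congrArg (fun ψ : Model n [⋀^Fin (k + 1)]→L[ℝ] ℝ => ψ.compContinuousLinearMap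
      (mfderiv (𝓡 n) 𝓘(ℝ, Model n) (extChartAt (𝓡 n) x) x)) h
  map_smul' c η := Subtype.ext <| funext fun x => by
    have h := extDeriv_smul c (chartRep η.1 x) (x := extChartAt (𝓡 n) x x)
    exact congrArg (fun ψ : Model n [⋀^Fin (k + 1)]→L[ℝ] ℝ => ψ.compContinuousLinearMap
      (mfderiv (𝓡 n) 𝓘(ℝ, Model n) (extChartAt (𝓡 n) x) x)) h

/-- `d ∘ d = 0`. -/
theorem deRham_deRham [IsManifold (𝓡 n) ∞ X] {k : ℕ} (η : DiffForm n X k) :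
    deRham n X (k + 1) (deRham n X k η) = 0 := Subtype.ext <| funext fun x => by
  have hx := mem_extChartAt_target (I := 𝓡 n) x
  have hev : chartRep (extDerivForm η.1) x =ᶠ[𝓝 (extChartAt (𝓡 n) x x)]
      extDeriv (chartRep η.1 x) := by
    filter_upwards [(isOpen_extChartAt_target x).mem_nhds hx] with z hz
    exact chartRep_extDerivForm η x hz
  have h : extDeriv (chartRep (extDerivForm η.1) x) (extChartAt (𝓡 n) x x) = 0 := by
    rw [hev.extDeriv_eq]
    exact extDeriv_extDeriv_apply
      ((η.2 x).contDiffAt ((isOpen_extChartAt_target x).mem_nhds hx))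
      two_le_smooth
  exact congrArg (fun ψ : Model n [⋀^Fin (k + 2)]→L[ℝ] ℝ => ψ.compContinuousLinearMap
      (mfderiv (𝓡 n) 𝓘(ℝ, Model n) (extChartAt (𝓡 n) x) x)) h

/-- `[d, f] η = df ∧ η`, at a point in the chart at that point. -/
theorem commutator_deRham [IsManifold (𝓡 n) ∞ X] {k : ℕ} (f : SmoothFun n X)
    (η : DiffForm n X k) (x : X) :
    (commutator (deRham n X k) f η).1 x =
      (ContinuousAlternatingMap.alternatizeUncurryFin
        ((fderiv ℝ (fun y => f ((extChartAt (𝓡 n) x).symm y)) (extChartAt (𝓡 n) x x)).smulRight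
          (chartRep η.1 x (extChartAt (𝓡 n) x x)))).compContinuousLinearMap
        (mfderiv (𝓡 n) 𝓘(ℝ, Model n) (extChartAt (𝓡 n) x) x) := by
  have hf : DifferentiableAt ℝ (fun y => f ((extChartAt (𝓡 n) x).symm y))
      (extChartAt (𝓡 n) x x) :=
    ((contDiffOn_comp_chart f x).contDiffAt ((isOpen_extChartAt_target x).mem_nhds
      (mem_extChartAt_target x))).differentiableAt (by simp)
  have h : extDeriv (chartRep (f • η).1 x) (extChartAt (𝓡 n) x x) -
      f x • extDeriv (chartRep η.1 x) (extChartAt (𝓡 n) x x) =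
      ContinuousAlternatingMap.alternatizeUncurryFin
        ((fderiv ℝ (fun y => f ((extChartAt (𝓡 n) x).symm y)) (extChartAt (𝓡 n) x x)).smulRight
          (chartRep η.1 x (extChartAt (𝓡 n) x x))) := by
    have h1 : chartRep (f • η).1 x =
        (fun y => f ((extChartAt (𝓡 n) x).symm y)) • chartRep η.1 x := rfl
    rw [h1, extDeriv, extDeriv, fderiv_smul hf (DiffForm.differentiableAt η x),
      ContinuousAlternatingMap.alternatizeUncurryFin_add,
      ContinuousAlternatingMap.alternatizeUncurryFin_smul, extChartAt_to_inv]
    abel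
  exact congrArg (fun ψ : Model n [⋀^Fin (k + 1)]→L[ℝ] ℝ => ψ.compContinuousLinearMap
      (mfderiv (𝓡 n) 𝓘(ℝ, Model n) (extChartAt (𝓡 n) x) x)) h

/-- The de Rham differential is a differential operator of first order. -/
theorem hasOrderLT_deRham [IsManifold (𝓡 n) ∞ X] (k : ℕ) :
    HasOrderLT (SmoothFun n X) 2 (deRham n X k) := by
  intro f g
  refine LinearMap.ext fun η => Subtype.ext <| funext fun x => ?_
  change (commutator (deRham n X k) f (g • η)).1 x - g x • (commutator (deRham n X k) f η).1 x = 0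
  rw [commutator_deRham, commutator_deRham]
  have h1 : chartRep (g • η).1 x (extChartAt (𝓡 n) x x) =
      g x • chartRep η.1 x (extChartAt (𝓡 n) x x) := by
    rw [show (g • η).1 = fun x => g x • η.1 x from rfl, chartRep_smul]
    simp only [extChartAt_to_inv]
  rw [h1, sub_eq_zero]
  have h2 := ContinuousAlternatingMap.alternatizeUncurryFin_smul (g x)
    ((fderiv ℝ (fun y => f ((extChartAt (𝓡 n) x).symm y)) (extChartAt (𝓡 n) x x)).smulRight
          (chartRep η.1 x (extChartAt (𝓡 n) x x)))
  have h3 : ∀ (L : Model n →L[ℝ] ℝ) (c : ℝ) (w : Model n [⋀^Fin k]→L[ℝ] ℝ),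
      L.smulRight (c • w) = c • L.smulRight w := by
    exact fun L c w => ContinuousLinearMap.ext fun v => smul_comm (L v) c w
  rw [h3, h2]
  rfl

end Forms

end DiffOpCohomology

namespace DiffOpCohomology

/-! ### Sections of a vector bundle `α` and of the conjugate bundle `α̂ = Hom(α, Λ^n_X)` -/

section Bundle

variable (n : ℕ) {X : Type*} [TopologicalSpace X] [ChartedSpace (Model n) X]
  (F : Type*) [NormedAddCommGroup F] [NormedSpace ℝ F]
  (V : X → Type*) [TopologicalSpace (Bundle.TotalSpace F V)] [∀ x, AddCommGroup (V x)]
  [∀ x, Module ℝ (V x)] [∀ x, TopologicalSpace (V x)] [FiberBundle F V] [VectorBundle ℝ F V]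

/-- `Γ(α)`: the smooth sections of the vector bundle `α` with total space `V`. -/
abbrev Sections : Type _ := Cₛ^∞⟮𝓡 n; F, V⟯

instance : Module (SmoothFun n X) (Sections n F V) where
  smul f s := ⟨fun x => f x • s x, f.contMDiff.smul_section s.contMDiff⟩
  one_smul s := ContMDiffSection.ext fun x => one_smul ℝ (s x)
  mul_smul f g s := ContMDiffSection.ext fun x => mul_smul (f x) (g x) (s x)
  smul_zero f := ContMDiffSection.ext fun x => smul_zero (f x)
  smul_add f s t := ContMDiffSection.ext fun x => smul_add (f x) (s x) (t x)
  add_smul f g s := ContMDiffSection.ext fun x => add_smul (f x) (g x) (s x)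
  zero_smul s := ContMDiffSection.ext fun x => zero_smul ℝ (s x)

instance : IsScalarTower ℝ (SmoothFun n X) (Sections n F V) where
  smul_assoc c f s := ContMDiffSection.ext fun x => smul_assoc c (f x) (s x)

/-- The fibre `Hom(α_x, Λ^n T*_x X)` of `α̂` at `x`. -/
def ConjFibre (x : X) : Type _ := V x →ₗ[ℝ] FormAt n n x

instance (x : X) : AddCommGroup (ConjFibre n V x) :=
  inferInstanceAs (AddCommGroup (V x →ₗ[ℝ] FormAt n n x))

instance (x : X) : Module ℝ (ConjFibre n V x) :=
  inferInstanceAs (Module ℝ (V x →ₗ[ℝ] FormAt n n x))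

variable {n V} in
/-- Evaluation of an element of `Hom(α_x, Λ^n T*_x X)`. -/
def ConjFibre.eval {x : X} (a : ConjFibre n V x) (v : V x) : FormAt n n x :=
  (show V x →ₗ[ℝ] FormAt n n x from a) v

/-- The smooth sections of `α̂ = Hom(α, Λ^n_X)`: the families of linear maps
`α_x → Λ^n T*_x X` that take smooth sections of `α` to smooth `n`-forms. -/
def smoothConjSections : Submodule ℝ (∀ x : X, ConjFibre n V x) where
  carrier := {A | ∀ s : Sections n F V, (fun x => (A x).eval (s x)) ∈ smoothForms n X n}
  zero_mem' := fun _ => zero_mem (smoothForms n X n)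
  add_mem' := fun h h' s => add_mem (h s) (h' s)
  smul_mem' := fun c _ h s => Submodule.smul_mem _ c (h s)

/-- `Γ(α̂)`: the space of smooth sections of `α̂ = Hom(α, Λ^n_X)`. -/
def ConjSections : Type _ := smoothConjSections n F V

instance : AddCommGroup (ConjSections n F V) :=
  inferInstanceAs (AddCommGroup (smoothConjSections n F V))

instance : Module ℝ (ConjSections n F V) :=
  inferInstanceAs (Module ℝ (smoothConjSections n F V))

variable {n F V} in
/-- The pairing `⟨A, s⟩ ∈ Ω^n(X)` of a section of `α̂` with a section of `α`. -/
def pairing (A : ConjSections n F V) (s : Sections n F V) : DiffForm n X n :=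
  ⟨fun x => (A.1 x).eval (s x), A.2 s⟩

variable [IsManifold (𝓡 n) ∞ X]

instance : Module (SmoothFun n X) (ConjSections n F V) where
  smul f A := ⟨fun x => f x • A.1 x, fun s => (f • pairing A s).2⟩
  one_smul A := Subtype.ext (funext fun x => one_smul ℝ (A.1 x))
  mul_smul f g A := Subtype.ext (funext fun x => mul_smul (f x) (g x) (A.1 x))
  smul_zero f := Subtype.ext (funext fun x => smul_zero (f x))
  smul_add f A B := Subtype.ext (funext fun x => smul_add (f x) (A.1 x) (B.1 x))
  add_smul f g A := Subtype.ext (funext fun x => add_smul (f x) (g x) (A.1 x))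
  zero_smul A := Subtype.ext (funext fun x => zero_smul ℝ (A.1 x))

instance : IsScalarTower ℝ (SmoothFun n X) (ConjSections n F V) where
  smul_assoc c f A := Subtype.ext (funext fun x => smul_assoc c (f x) (A.1 x))

/-! ### The complex `Sym^l D(α, Λ^•_X)` and its cohomology -/

/-- `Sym^l D(α, Λ^i_X)`: the `l`-linear symmetric differential operators from sections of `α` to
`i`-forms. -/
abbrev SymOp (l i : ℕ) : Type _ :=
  SymDiffOp (SmoothFun n X) (Sections n F V) (DiffForm n X i) l

/-- The differential `Sym^l D(α, Λ^i_X) → Sym^l D(α, Λ^{i+1}_X)`: left composition with the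
de Rham differential. -/
def symOpD (l i : ℕ) : SymOp n F V l i →ₗ[ℝ] SymOp n F V l (i + 1) where
  toFun Δ := ⟨(deRham n X i).compMultilinearMap Δ.1,
    comp_mem_symDiffOp (hasOrderLT_deRham i) Δ.2⟩
  map_add' Δ Δ' := Subtype.ext <| MultilinearMap.ext fun s =>
    (deRham n X i).map_add (Δ.1 s) (Δ'.1 s)
  map_smul' c Δ := Subtype.ext <| MultilinearMap.ext fun s =>
    (deRham n X i).map_smul c (Δ.1 s)

theorem symOpD_symOpD (l i : ℕ) (Δ : SymOp n F V l i) :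
    symOpD n F V l (i + 1) (symOpD n F V l i Δ) = 0 :=
  Subtype.ext <| MultilinearMap.ext fun s => deRham_deRham (Δ.1 s)

/-- The coboundaries of degree `i` of the complex `Sym^l D(α, Λ^•_X)`. -/
def symCoboundaries (l : ℕ) : ∀ i : ℕ, Submodule ℝ (SymOp n F V l i)
  | 0 => ⊥
  | i + 1 => LinearMap.range (symOpD n F V l i)

/-- The cohomology `H^i(Sym^l D(α, Λ^•_X))`: cocycles modulo coboundaries. -/
abbrev symCohomology (l i : ℕ) : Type _ :=
  LinearMap.ker (symOpD n F V l i) ⧸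
    (symCoboundaries n F V l i).submoduleOf (LinearMap.ker (symOpD n F V l i))

variable {n F V} in
/-- The cohomology class of a cocycle. -/
def symClass {l i : ℕ} (Δ : LinearMap.ker (symOpD n F V l i)) : symCohomology n F V l i :=
  Submodule.Quotient.mk Δ

/-! ### Formal adjoints -/

/-- The `l`-linear differential operators (not necessarily symmetric) from sections of `α` to
`i`-forms that are of the form `d ∘ G`, with `G` an `l`-linear differential operator with values
in `(i - 1)`-forms. -/
def exactOp (l : ℕ) : ∀ i : ℕ,
    Submodule ℝ (MultilinearMap ℝ (fun _ : Fin l => Sections n F V) (DiffForm n X i))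
  | 0 => ⊥
  | i + 1 => {
      carrier := {Δ | ∃ G ∈ multiDiffOp (SmoothFun n X) (Sections n F V) (DiffForm n X i) l,
        Δ = (deRham n X i).compMultilinearMap G}
      zero_mem' := ⟨0, zero_mem _, MultilinearMap.ext fun _ => (map_zero (deRham n X i)).symm⟩
      add_mem' := by
        rintro _ _ ⟨G, hG, rfl⟩ ⟨G', hG', rfl⟩
        exact ⟨G + G', add_mem hG hG', MultilinearMap.ext fun s =>
          ((deRham n X i).map_add (G s) (G' s)).symm⟩
      smul_mem' := by
        rintro c _ ⟨G, hG, rfl⟩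
        exact ⟨c • G, Submodule.smul_mem _ c hG, MultilinearMap.ext fun s =>
          ((deRham n X i).map_smul c (G s)).symm⟩ }

variable {n F V} in
/-- `Δ'` is the formal adjoint of `Δ`, for two linear differential operators `α → α̂` (the bundle
conjugate to `α̂` being `α` itself): Green's formula
`⟨Δ s, t⟩ - ⟨Δ' t, s⟩ = d (G(s, t))` holds with a bidifferential operator `G`. -/
def IsFormalAdjoint (Δ Δ' : Sections n F V →ₗ[ℝ] ConjSections n F V) : Prop :=
  ∃ E ∈ exactOp n F V 2 n, ∀ s t : Sections n F V,
    pairing (Δ s) t - pairing (Δ' t) s = E ![s, t]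

theorem IsFormalAdjoint.zero :
    IsFormalAdjoint (0 : Sections n F V →ₗ[ℝ] ConjSections n F V) 0 :=
  ⟨0, zero_mem _, fun _ _ => sub_self (0 : DiffForm n X n)⟩

variable {n F V} in
theorem IsFormalAdjoint.add {Δ Δ' D D' : Sections n F V →ₗ[ℝ] ConjSections n F V}
    (h : IsFormalAdjoint Δ Δ') (h' : IsFormalAdjoint D D') :
    IsFormalAdjoint (Δ + D) (Δ' + D') := by
  obtain ⟨E, hE, h⟩ := h
  obtain ⟨E', hE', h'⟩ := h'
  refine ⟨E + E', add_mem hE hE', fun s t => ?_⟩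
  have h1 : pairing ((Δ + D) s) t = pairing (Δ s) t + pairing (D s) t := rfl
  have h2 : pairing ((Δ' + D') t) s = pairing (Δ' t) s + pairing (D' t) s := rfl
  have h3 : (E + E') ![s, t] = E ![s, t] + E' ![s, t] := rfl
  rw [h1, h2, h3, ← h, ← h']; abel

variable {n F V} in
theorem IsFormalAdjoint.smul (c : ℝ) {Δ Δ' : Sections n F V →ₗ[ℝ] ConjSections n F V}
    (h : IsFormalAdjoint Δ Δ') : IsFormalAdjoint (c • Δ) (c • Δ') := by
  obtain ⟨E, hE, h⟩ := h
  refine ⟨c • E, Submodule.smul_mem _ c hE, fun s t => ?_⟩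
  have h3 : (c • E) ![s, t] = c • E ![s, t] := rfl
  rw [h3, ← h, smul_sub]
  rfl

/-- `Sym^m_self D(α, α̂)`: the `m`-linear symmetric differential operators from sections of `α` to
sections of `α̂` that are formally self-adjoint with respect to each argument. -/
def selfAdjointOp (m : ℕ) :
    Submodule ℝ (MultilinearMap ℝ (fun _ : Fin m => Sections n F V) (ConjSections n F V)) where
  carrier := {D | D ∈ symDiffOp (SmoothFun n X) (Sections n F V) (ConjSections n F V) m ∧
    ∀ (s : Fin m → Sections n F V) (i : Fin m),
      IsFormalAdjoint (D.toLinearMap s i) (D.toLinearMap s i)}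
  zero_mem' := ⟨zero_mem _, fun s i => by
    rw [toLinearMap_zero]; exact IsFormalAdjoint.zero n F V⟩
  add_mem' := fun {D D'} h h' => ⟨add_mem h.1 h'.1, fun s i => by
    rw [toLinearMap_add]; exact (h.2 s i).add (h'.2 s i)⟩
  smul_mem' := fun c D h => ⟨Submodule.smul_mem _ c h.1, fun s i => by
    rw [toLinearMap_smul]; exact (h.2 s i).smul c⟩

end Bundle

end DiffOpCohomology

end

open DiffOpCohomology

/-!
Let `A = C^∞(X)` and `P = Γ(α)`. The commutators `[Δ, f]` with functions make "order" an algebraic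
notion on `Hom(P, Ω^i)`, and everything is done by induction on the order.

For linear operators, let `h Δ = ∑_c ρ_c ∑_j ι_{∂_j^c} ∘ [Δ, f_{c,j}]`, where `ρ` is a partition of
unity subordinate to the charts, and `f_{c,j}` and `∂_j^c` are the coordinates and the coordinate
vector fields of the chart at `c` (`nonempty_eulerHomotopy`). On operators of order `k` with values
in `i`-forms, `Δ ↦ h (d ∘ Δ) + d ∘ h Δ` is multiplication by `n - i + k` up to operators of smaller
order (`hasOrderLT_euler`): on symbols this is Euler's identity for the Koszul complex. Whenever
`n - i + k ≠ 0`, a closed `Δ` may be replaced by `Δ - (n - i + k)⁻¹ d ∘ h Δ`, of smaller order. For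
`i < n` this ends with `0`, so that `Δ` is exact; for `i = n` it ends with an operator of order zero
(`EulerHomotopy.hasOrderLT_sub_primitive`). An operator of order zero with values in `n`-forms that
is exact vanishes (`EulerHomotopy.d_comp_eq_zero`), and operators of order zero are the sections of
`α̂` (`exists_conjSection`).

A multilinear operator is treated through its last argument, for fixed values of the others. As `h`
is `A`-linear and commutes with `[·, g]`, the primitives obtained are again differential operators
in all arguments (`IsRegular.mapLast_mem`). This gives vanishing of the cohomology in degrees `< n`
after averaging the primitive over the permutations of the arguments, and in degree `n` a unique
operator `D` such that `Δ - ⟨D(s₁, …, s_m), s_{m+1}⟩` is exact. Moreover an operator with values in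
`n`-forms that is exact in its last argument for all values of the others is exact
(`mem_exactOp_of_curryRight`).

If `Δ` is symmetric, uniqueness of `D` shows that `D` is symmetric, and the exchange of an argument
of `D` with the last one of `Δ` gives Green's formula (`mem_selfAdjointOp_of_sub_mem_exactOp`).
Conversely, if `D` is symmetric and self-adjoint, then the permutations of the arguments change
`⟨D(s₁, …, s_m), s_{m+1}⟩` by exact operators only, since Green's formula says that the change is
exact in one argument (`domDomCongr_pairLast_sub_mem_exactOp`); thus the symmetrization of this
operator represents a class which corresponds to `D`.
-/

namespace DiffOpCohomology

/-! ### Commutators and orders -/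

section CommutatorAlgebra

variable {A : Type*} [CommRing A] [Algebra ℝ A]
  {P : Type*} [AddCommGroup P] [Module ℝ P] [Module A P] [IsScalarTower ℝ A P]
  {Q : Type*} [AddCommGroup Q] [Module ℝ Q] [Module A Q] [IsScalarTower ℝ A Q]
  {R : Type*} [AddCommGroup R] [Module ℝ R] [Module A R] [IsScalarTower ℝ A R]

@[simp] theorem commutator_add_left (Δ Δ' : P →ₗ[ℝ] Q) (f : A) :
    commutator (Δ + Δ') f = commutator Δ f + commutator Δ' f := by
  ext p; simp only [commutator_apply, LinearMap.add_apply, smul_add]; abel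

@[simp] theorem commutator_sub_left (Δ Δ' : P →ₗ[ℝ] Q) (f : A) :
    commutator (Δ - Δ') f = commutator Δ f - commutator Δ' f := by
  ext p; simp only [commutator_apply, LinearMap.sub_apply, smul_sub]; abel

@[simp] theorem commutator_smul_left (c : ℝ) (Δ : P →ₗ[ℝ] Q) (f : A) :
    commutator (c • Δ) f = c • commutator Δ f := by
  ext p
  have := smul_algebra_smul_comm c f (Δ p)
  simp only [commutator_apply, LinearMap.smul_apply, smul_sub, this]

theorem commutator_comp (D : Q →ₗ[ℝ] R) (Δ : P →ₗ[ℝ] Q) (f : A) :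
    commutator (D ∘ₗ Δ) f = commutator D f ∘ₗ Δ + D ∘ₗ commutator Δ f := by
  ext p; simp

theorem commutator_comm (Δ : P →ₗ[ℝ] Q) (f g : A) :
    commutator (commutator Δ f) g = commutator (commutator Δ g) f := by
  ext p
  simp only [commutator_apply, smul_sub, smul_smul, mul_comm f g]
  abel

theorem HasOrderLT.neg {k : ℕ} {Δ : P →ₗ[ℝ] Q} (h : HasOrderLT A k Δ) : HasOrderLT A k (-Δ) := by
  simpa using h.smul (-1)

theorem HasOrderLT.of_smul {c : ℝ} (hc : c ≠ 0) {k : ℕ} {Δ : P →ₗ[ℝ] Q}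
    (h : HasOrderLT A k (c • Δ)) : HasOrderLT A k Δ := by
  have := h.smul c⁻¹
  rwa [smul_smul, inv_mul_cancel₀ hc, one_smul] at this

theorem hasOrderLT_one_iff {Δ : P →ₗ[ℝ] Q} :
    HasOrderLT A 1 Δ ↔ ∀ (f : A) (p : P), Δ (f • p) = f • Δ p := by
  refine forall_congr' fun f => ?_
  change commutator Δ f = 0 ↔ _
  rw [LinearMap.ext_iff]
  simp [sub_eq_zero]

theorem HasOrderLT.map_smul {Δ : P →ₗ[ℝ] Q} (h : HasOrderLT A 1 Δ) (f : A) (p : P) :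
    Δ (f • p) = f • Δ p := hasOrderLT_one_iff.1 h f p

theorem commutator_comp_of_order_one {D : Q →ₗ[ℝ] R} (hD : HasOrderLT A 1 D) (Δ : P →ₗ[ℝ] Q)
    (f : A) : commutator (D ∘ₗ Δ) f = D ∘ₗ commutator Δ f := by
  rw [commutator_comp, show commutator D f = 0 from hD f, LinearMap.zero_comp, zero_add]

/-- Multiplication by an element of the algebra is an operator of order zero. -/
theorem hasOrderLT_one_lsmul (f : A) : HasOrderLT A 1 (Algebra.lsmul ℝ ℝ P f : P →ₗ[ℝ] P) :=
  hasOrderLT_one_iff.2 fun g p => by simp [smul_smul, mul_comm]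

/-- The order of an operator can be tested after composition with a jointly injective family of
operators of order zero. -/
theorem hasOrderLT_of_forall_comp {ι : Type*} {φ : ι → Q →ₗ[ℝ] R}
    (hφ : ∀ t, HasOrderLT A 1 (φ t)) (hinj : ∀ q, (∀ t, φ t q = 0) → q = 0) {k : ℕ} :
    ∀ {Δ : P →ₗ[ℝ] Q}, (∀ t, HasOrderLT A k (φ t ∘ₗ Δ)) → HasOrderLT A k Δ := by
  induction k with
  | zero =>
    intro Δ h
    exact LinearMap.ext fun p => hinj _ fun t => LinearMap.congr_fun (h t) p
  | succ k ih =>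
    intro Δ h f
    refine ih fun t => ?_
    rw [← commutator_comp_of_order_one (hφ t)]
    exact h t f

omit [Module A P] [IsScalarTower ℝ A P] in
/-- Evaluation at a point is of order zero, for the module structure of the target. -/
theorem hasOrderLT_one_applyₗ (p : P) :
    HasOrderLT A 1 (LinearMap.applyₗ p : (P →ₗ[ℝ] Q) →ₗ[ℝ] Q) :=
  hasOrderLT_one_iff.2 fun _ _ => rfl

/-- Let `N` act on operators `P → Q` in such a way that `[N Δ, g] = N [Δ, g] + K g Δ`, where `K g`
commutes with commutators and `K g Δ = [Δ, g]` for `Δ` of order `≤ 1`. If `N` is the scalar `e` on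
operators of order `0`, then it is the scalar `e + k` on operators of order `k`, up to operators of
smaller order: each commutator that lowers the order to zero contributes `1`. -/
theorem hasOrderLT_euler {N : (P →ₗ[ℝ] Q) → (P →ₗ[ℝ] Q)}
    {K : A → (P →ₗ[ℝ] Q) → (P →ₗ[ℝ] Q)} {e : ℝ}
    (hN : ∀ (Δ : P →ₗ[ℝ] Q) (g : A), commutator (N Δ) g = N (commutator Δ g) + K g Δ)
    (hK : ∀ (Δ : P →ₗ[ℝ] Q) (f g : A), commutator (K g Δ) f = K g (commutator Δ f))
    (hK2 : ∀ (Δ : P →ₗ[ℝ] Q) (g : A), HasOrderLT A 2 Δ → K g Δ = commutator Δ g)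
    (h1 : ∀ Δ : P →ₗ[ℝ] Q, HasOrderLT A 1 Δ → N Δ = e • Δ) {k : ℕ} :
    ∀ {Δ : P →ₗ[ℝ] Q}, HasOrderLT A (k + 1) Δ → HasOrderLT A k (N Δ - (e + k) • Δ) := by
  have hlow : ∀ k : ℕ, ∀ {Δ : P →ₗ[ℝ] Q} (g : A), HasOrderLT A (k + 2) Δ →
      HasOrderLT A k (K g Δ - commutator Δ g) := by
    intro k
    induction k with
    | zero => exact fun g h => by rw [hK2 _ g h, sub_self]; rfl
    | succ k ih =>
      intro Δ g h f
      rw [commutator_sub_left, hK, commutator_comm Δ g f]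
      exact ih g (h f)
  induction k with
  | zero =>
    intro Δ h
    rw [h1 Δ h]; simp [HasOrderLT]
  | succ k ih =>
    intro Δ h g
    have h2 := (ih (h g)).add (hlow k g h)
    convert h2 using 1
    rw [commutator_sub_left, hN, commutator_smul_left]
    push_cast
    module

/-! ### Operators acting on operators, and their action on the last argument -/

variable (A) in
/-- A linear operation `Θ` taking operators `P → Q` to operators `P → R` is *regular* if it is
itself a differential operator, for the module structures induced from `Q` and `R`, and if it
preserves boundedness of orders. -/
structure IsRegular (Θ : (P →ₗ[ℝ] Q) →ₗ[ℝ] (P →ₗ[ℝ] R)) : Prop where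
  exists_order : ∃ c, HasOrderLT A c Θ
  bounded : ∀ m, ∃ m', ∀ Δ, HasOrderLT A m Δ → HasOrderLT A m' (Θ Δ)

theorem IsRegular.zero : IsRegular A (0 : (P →ₗ[ℝ] Q) →ₗ[ℝ] (P →ₗ[ℝ] R)) :=
  ⟨⟨0, rfl⟩, fun _ => ⟨0, fun _ _ => rfl⟩⟩

theorem IsRegular.id : IsRegular A (LinearMap.id : (P →ₗ[ℝ] Q) →ₗ[ℝ] (P →ₗ[ℝ] Q)) :=
  ⟨⟨1, hasOrderLT_one_iff.2 fun _ _ => rfl⟩, fun m => ⟨m, fun _ h => h⟩⟩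

theorem IsRegular.add {Θ Θ' : (P →ₗ[ℝ] Q) →ₗ[ℝ] (P →ₗ[ℝ] R)} (h : IsRegular A Θ)
    (h' : IsRegular A Θ') : IsRegular A (Θ + Θ') := by
  obtain ⟨⟨c, hc⟩, hb⟩ := h
  obtain ⟨⟨c', hc'⟩, hb'⟩ := h'
  refine ⟨⟨max c c', (hc.mono (le_max_left _ _)).add (hc'.mono (le_max_right _ _))⟩, fun m => ?_⟩
  obtain ⟨a, ha⟩ := hb m
  obtain ⟨a', ha'⟩ := hb' m
  exact ⟨max a a', fun Δ hΔ =>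
    ((ha Δ hΔ).mono (le_max_left _ _)).add ((ha' Δ hΔ).mono (le_max_right _ _))⟩

theorem IsRegular.smul (r : ℝ) {Θ : (P →ₗ[ℝ] Q) →ₗ[ℝ] (P →ₗ[ℝ] R)} (h : IsRegular A Θ) :
    IsRegular A (r • Θ) := by
  obtain ⟨⟨c, hc⟩, hb⟩ := h
  refine ⟨⟨c, hc.smul r⟩, fun m => ?_⟩
  obtain ⟨a, ha⟩ := hb m
  exact ⟨a, fun Δ hΔ => (ha Δ hΔ).smul r⟩

theorem IsRegular.comp {S : Type*} [AddCommGroup S] [Module ℝ S] [Module A S]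
    [IsScalarTower ℝ A S] {Θ' : (P →ₗ[ℝ] R) →ₗ[ℝ] (P →ₗ[ℝ] S)}
    {Θ : (P →ₗ[ℝ] Q) →ₗ[ℝ] (P →ₗ[ℝ] R)} (h' : IsRegular A Θ') (h : IsRegular A Θ) :
    IsRegular A (Θ' ∘ₗ Θ) := by
  obtain ⟨⟨c, hc⟩, hb⟩ := h
  obtain ⟨⟨c', hc'⟩, hb'⟩ := h'
  refine ⟨⟨c' + c, hc'.comp hc⟩, fun m => ?_⟩
  obtain ⟨a, ha⟩ := hb m
  obtain ⟨a', ha'⟩ := hb' a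
  exact ⟨a', fun Δ hΔ => ha' _ (ha Δ hΔ)⟩

/-- Left composition with a differential operator is regular. -/
theorem IsRegular.compRight {D : Q →ₗ[ℝ] R} {a : ℕ} (hD : HasOrderLT A a D) :
    IsRegular A (LinearMap.compRight ℝ D : (P →ₗ[ℝ] Q) →ₗ[ℝ] (P →ₗ[ℝ] R)) := by
  refine ⟨⟨a, ?_⟩, fun m => ⟨a + m, fun Δ hΔ => hD.comp hΔ⟩⟩
  induction a generalizing D with
  | zero => rw [show D = 0 from hD]; exact LinearMap.ext fun Δ => LinearMap.zero_comp Δ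
  | succ a ih =>
    intro f
    have h : commutator (LinearMap.compRight ℝ D : (P →ₗ[ℝ] Q) →ₗ[ℝ] (P →ₗ[ℝ] R)) f =
        LinearMap.compRight ℝ (commutator D f) := rfl
    rw [h]
    exact ih (hD f)

/-- The application of an operation on operators `P → Q` to a multilinear operator, seen as an
operator in its last argument. -/
def mapLast (Θ : (P →ₗ[ℝ] Q) →ₗ[ℝ] (P →ₗ[ℝ] R)) {m : ℕ}
    (Δ : MultilinearMap ℝ (fun _ : Fin (m + 1) => P) Q) :
    MultilinearMap ℝ (fun _ : Fin (m + 1) => P) R :=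
  MultilinearMap.uncurryRight (Θ.compMultilinearMap (MultilinearMap.curryRight Δ))

theorem curryRight_mapLast (Θ : (P →ₗ[ℝ] Q) →ₗ[ℝ] (P →ₗ[ℝ] R)) {m : ℕ}
    (Δ : MultilinearMap ℝ (fun _ : Fin (m + 1) => P) Q) (s : Fin m → P) :
    (mapLast Θ Δ).curryRight s = Θ (Δ.curryRight s) := by
  rw [mapLast, MultilinearMap.curry_uncurryRight]; rfl

/-- A multilinear differential operator is the same as a multilinear family of linear differential
operators in the last argument: the dependence on the other arguments is a differential operator
with values in the module of linear operators. -/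
theorem mem_multiDiffOp_succ_iff {m : ℕ} {Δ : MultilinearMap ℝ (fun _ : Fin (m + 1) => P) Q} :
    Δ ∈ multiDiffOp A P Q (m + 1) ↔
      (∃ c, ∀ (s : Fin m → P) (j : Fin m), HasOrderLT A c (Δ.curryRight.toLinearMap s j)) ∧
        ∃ k, ∀ s : Fin m → P, HasOrderLT A k (Δ.curryRight s) := by
  constructor
  · rintro ⟨k, hk⟩
    refine ⟨⟨k, fun s j => ?_⟩, ⟨k, fun s => ?_⟩⟩
    · refine hasOrderLT_of_forall_comp (A := A) (φ := fun p : P => LinearMap.applyₗ p)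
        (fun p => hasOrderLT_one_applyₗ p) (fun q hq => LinearMap.ext hq) fun p => ?_
      convert hk (Fin.snoc s p) j.castSucc using 1
      ext q
      simp [Fin.snoc_update]
    · convert hk (Fin.snoc s 0) (Fin.last m) using 1
      ext q
      simp [Fin.update_snoc_last]
  · rintro ⟨⟨c, hc⟩, ⟨k, hk⟩⟩
    refine ⟨max (1 + c) k, fun s j => ?_⟩
    induction j using Fin.lastCases with
    | last =>
      refine HasOrderLT.mono (le_max_right _ _) ?_
      convert hk (Fin.init s) using 1
      ext q
      have h : Function.update s (Fin.last m) q = Fin.snoc (Fin.init s) q := by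
        conv_lhs => rw [← Fin.snoc_init_self s, Fin.update_snoc_last]
      exact congrArg Δ h
    | cast j =>
      refine HasOrderLT.mono (le_max_left _ _) ?_
      convert (hasOrderLT_one_applyₗ (s (Fin.last m))).comp (hc (Fin.init s) j) using 1
      ext q
      have h : Function.update s j.castSucc q =
          Fin.snoc (Function.update (Fin.init s) j q) (s (Fin.last m)) := by
        conv_lhs => rw [← Fin.snoc_init_self s, ← Fin.snoc_update]
      exact congrArg Δ h

/-- A regular operation maps multilinear differential operators to such operators. -/
theorem IsRegular.mapLast_mem {Θ : (P →ₗ[ℝ] Q) →ₗ[ℝ] (P →ₗ[ℝ] R)} (h : IsRegular A Θ) {m : ℕ}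
    {Δ : MultilinearMap ℝ (fun _ : Fin (m + 1) => P) Q} (hΔ : Δ ∈ multiDiffOp A P Q (m + 1)) :
    mapLast Θ Δ ∈ multiDiffOp A P R (m + 1) := by
  rw [mem_multiDiffOp_succ_iff] at hΔ ⊢
  obtain ⟨⟨c, hc⟩, ⟨k, hk⟩⟩ := hΔ
  obtain ⟨⟨a, ha⟩, hb⟩ := h
  obtain ⟨k', hk'⟩ := hb k
  refine ⟨⟨a + c, fun s j => ?_⟩, ⟨k', fun s => ?_⟩⟩
  · rw [mapLast, MultilinearMap.curry_uncurryRight]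
    exact ha.comp (hc s j)
  · rw [curryRight_mapLast]
    exact hk' _ (hk s)

end CommutatorAlgebra

/-! ### Primitives of operators with values in a complex -/

section EulerHomotopy

variable {A : Type*} [CommRing A] [Algebra ℝ A]
  {P : Type*} [AddCommGroup P] [Module ℝ P] [Module A P] [IsScalarTower ℝ A P]
  {Ω : ℕ → Type*} [∀ i, AddCommGroup (Ω i)] [∀ i, Module ℝ (Ω i)] [∀ i, Module A (Ω i)]
  [∀ i, IsScalarTower ℝ A (Ω i)]

variable (A P) in
/-- An `A`-linear operation `h` lowering the degree of operators `P → Ω^•`, modelled on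
`Δ ↦ ∑_j ι_{∂_j} ∘ [Δ, x_j]` on `ℝⁿ`. The laws say that `h d + d h` acts as the scalar `n - i` on
operators of order zero with values in `Ω^i`, and that the failure of `h d + d h` to commute with
`[·, g]` is `[·, g]` itself on operators of order one. -/
structure EulerHomotopy (n : ℕ) (d : ∀ i, Ω i →ₗ[ℝ] Ω (i + 1)) where
  /-- The operation. -/
  h : ∀ i, (P →ₗ[ℝ] Ω (i + 1)) →ₗ[ℝ] (P →ₗ[ℝ] Ω i)
  h_smul : ∀ i (f : A) (Δ : P →ₗ[ℝ] Ω (i + 1)), h i (f • Δ) = f • h i Δ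
  commutator_h : ∀ i (Δ : P →ₗ[ℝ] Ω (i + 1)) (g : A),
    commutator (h i Δ) g = h i (commutator Δ g)
  h_of_order_one : ∀ i (Δ : P →ₗ[ℝ] Ω (i + 1)), HasOrderLT A 1 Δ → h i Δ = 0
  h_d : ∀ i (Δ : P →ₗ[ℝ] Ω i), HasOrderLT A 1 Δ → h i (d i ∘ₗ Δ) = ((n : ℝ) - i) • Δ
  h_wedge_zero : ∀ (Δ : P →ₗ[ℝ] Ω 0) (g : A), HasOrderLT A 2 Δ →
    h 0 (commutator (d 0) g ∘ₗ Δ) = commutator Δ g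
  h_wedge : ∀ i (Δ : P →ₗ[ℝ] Ω (i + 1)) (g : A), HasOrderLT A 2 Δ →
    h (i + 1) (commutator (d (i + 1)) g ∘ₗ Δ) + commutator (d i) g ∘ₗ h i Δ = commutator Δ g

namespace EulerHomotopy

variable {n : ℕ} {d : ∀ i, Ω i →ₗ[ℝ] Ω (i + 1)} (H : EulerHomotopy A P n d)

theorem isRegular_h (i : ℕ) : IsRegular A (H.h i) := by
  refine ⟨⟨1, hasOrderLT_one_iff.2 fun f Δ => H.h_smul i f Δ⟩, fun m => ⟨m, ?_⟩⟩
  induction m with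
  | zero => intro Δ hΔ; rw [show Δ = 0 from hΔ, _root_.map_zero]; rfl
  | succ m ih => intro Δ hΔ f; rw [H.commutator_h]; exact ih _ (hΔ f)

variable (hd : ∀ i, HasOrderLT A 2 (d i))
include H hd

/-- On operators of order `k` in degree `0`, `Δ ↦ h (d ∘ Δ)` is the scalar `n + k`, up to smaller
order. -/
theorem hasOrderLT_zero {k : ℕ} {Δ : P →ₗ[ℝ] Ω 0} (hΔ : HasOrderLT A (k + 1) Δ) :
    HasOrderLT A k (H.h 0 (d 0 ∘ₗ Δ) - ((n : ℝ) + k) • Δ) := by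
  refine hasOrderLT_euler (A := A) (N := fun Δ : P →ₗ[ℝ] Ω 0 => H.h 0 (d 0 ∘ₗ Δ))
    (K := fun g Δ => H.h 0 (commutator (d 0) g ∘ₗ Δ)) (e := n) ?_ ?_ ?_ ?_ hΔ
  · intro Δ g
    rw [H.commutator_h, commutator_comp, map_add, add_comm]
  · intro Δ f g
    rw [H.commutator_h, commutator_comp_of_order_one (hd 0 g)]
  · exact fun Δ g h => H.h_wedge_zero Δ g h
  · intro Δ h
    rw [H.h_d 0 Δ h, Nat.cast_zero, sub_zero]

/-- On operators of order `k` in degree `i > 0`, `Δ ↦ h (d ∘ Δ) + d ∘ h Δ` is the scalar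
`n - i + k`, up to smaller order. -/
theorem hasOrderLT_succ (i : ℕ) {k : ℕ} {Δ : P →ₗ[ℝ] Ω (i + 1)} (hΔ : HasOrderLT A (k + 1) Δ) :
    HasOrderLT A k (H.h (i + 1) (d (i + 1) ∘ₗ Δ) + d i ∘ₗ H.h i Δ -
      ((n : ℝ) - (i + 1 : ℕ) + k) • Δ) := by
  refine hasOrderLT_euler (A := A)
    (N := fun Δ : P →ₗ[ℝ] Ω (i + 1) => H.h (i + 1) (d (i + 1) ∘ₗ Δ) + d i ∘ₗ H.h i Δ)
    (K := fun g Δ => H.h (i + 1) (commutator (d (i + 1)) g ∘ₗ Δ) + commutator (d i) g ∘ₗ H.h i Δ)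
    (e := (n : ℝ) - (i + 1 : ℕ)) ?_ ?_ ?_ ?_ hΔ
  · intro Δ g
    rw [commutator_add_left, H.commutator_h, commutator_comp, commutator_comp, map_add,
      H.commutator_h]
    abel
  · intro Δ f g
    rw [commutator_add_left, H.commutator_h, commutator_comp_of_order_one (hd _ g),
      commutator_comp_of_order_one (hd _ g), H.commutator_h]
  · exact fun Δ g h => H.h_wedge i Δ g h
  · intro Δ h
    rw [H.h_d _ Δ h, H.h_of_order_one i Δ h, LinearMap.comp_zero, add_zero]

/-- In degree zero a closed operator is of order zero, and vanishes if `n` is positive. -/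
theorem hasOrderLT_of_closed_zero {k : ℕ} {Δ : P →ₗ[ℝ] Ω 0} (hΔ : HasOrderLT A k Δ)
    (hcl : d 0 ∘ₗ Δ = 0) : HasOrderLT A 1 Δ ∧ (0 < n → Δ = 0) := by
  have key : ∀ k : ℕ, (n : ℝ) + k ≠ 0 → HasOrderLT A (k + 1) Δ → HasOrderLT A k Δ := by
    intro k hk h
    have h1 := H.hasOrderLT_zero hd h
    rw [hcl, map_zero, zero_sub] at h1
    exact HasOrderLT.of_smul hk (by simpa using h1.neg)
  have h1 : HasOrderLT A 1 Δ := by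
    induction k with
    | zero => exact hΔ.succ
    | succ k ih =>
      rcases k with _ | k
      · exact hΔ
      · exact ih (key (k + 1) (by positivity) hΔ)
  exact ⟨h1, fun hn => key 0 (by simpa using hn.ne') h1⟩

omit hd in
/-- The operation that takes a closed operator of order `< k` to a primitive of it, up to an
operator of order zero in degree `n`. -/
noncomputable def primitive (i : ℕ) : ℕ → (P →ₗ[ℝ] Ω (i + 1)) →ₗ[ℝ] (P →ₗ[ℝ] Ω i)
  | 0 => 0
  | k + 1 => ((n : ℝ) - (i + 1 : ℕ) + k)⁻¹ • H.h i + primitive i k ∘ₗ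
      (LinearMap.id - ((n : ℝ) - (i + 1 : ℕ) + k)⁻¹ • (LinearMap.compRight ℝ (d i) ∘ₗ H.h i))

theorem isRegular_primitive (i k : ℕ) : IsRegular A (H.primitive i k) := by
  induction k with
  | zero => exact IsRegular.zero
  | succ k ih =>
    refine ((H.isRegular_h i).smul _).add (ih.comp ?_)
    rw [sub_eq_add_neg, ← neg_smul _ (LinearMap.compRight ℝ (d i) ∘ₗ H.h i)]
    exact IsRegular.id.add (((IsRegular.compRight (hd i)).comp (H.isRegular_h i)).smul _)

variable (hdd : ∀ i η, d (i + 1) (d i η) = 0)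
include hdd

/-- A closed operator in degree `i ≤ n` is, up to an operator of order zero, the composite of `d`
and its primitive; for `i < n` the error term vanishes. -/
theorem hasOrderLT_sub_primitive {i k : ℕ} (hi : i + 1 ≤ n) {Δ : P →ₗ[ℝ] Ω (i + 1)}
    (hΔ : HasOrderLT A k Δ) (hcl : d (i + 1) ∘ₗ Δ = 0) :
    HasOrderLT A 1 (Δ - d i ∘ₗ H.primitive i k Δ) ∧
      (i + 1 < n → Δ - d i ∘ₗ H.primitive i k Δ = 0) := by
  have hi' : (0 : ℝ) ≤ (n : ℝ) - (i + 1 : ℕ) := by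
    rw [sub_nonneg]; exact_mod_cast hi
  induction k generalizing Δ with
  | zero =>
    rw [show Δ = 0 from hΔ, map_zero, LinearMap.comp_zero, sub_zero]
    exact ⟨HasOrderLT.zero 1, fun _ => rfl⟩
  | succ k ih =>
    set e : ℝ := (n : ℝ) - (i + 1 : ℕ) + k with he
    have h1 := H.hasOrderLT_succ hd i hΔ
    rw [hcl, map_zero, zero_add, ← he] at h1
    have hrec : Δ - d i ∘ₗ H.primitive i (k + 1) Δ =
        (Δ - e⁻¹ • (d i ∘ₗ H.h i Δ)) - d i ∘ₗ H.primitive i k (Δ - e⁻¹ • (d i ∘ₗ H.h i Δ)) := by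
      have : H.primitive i (k + 1) Δ =
        e⁻¹ • H.h i Δ + H.primitive i k (Δ - e⁻¹ • (d i ∘ₗ H.h i Δ)) := rfl
      rw [this, LinearMap.comp_add, LinearMap.comp_smul]
      abel
    rw [hrec]
    rcases eq_or_ne e 0 with h0 | h0
    · -- This case occurs only in degree `n` for operators of order zero; then `e⁻¹ = 0`.
      have hk : k = 0 := by
        have : (k : ℝ) ≤ 0 := by linarith
        exact_mod_cast le_antisymm this (Nat.cast_nonneg k)
      subst hk
      rw [h0, inv_zero, zero_smul, sub_zero]
      have h2 : H.primitive i 0 Δ = 0 := rfl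
      rw [h2, LinearMap.comp_zero, sub_zero]
      refine ⟨hΔ, fun hlt => absurd h0 (ne_of_gt ?_)⟩
      have : ((i + 1 : ℕ) : ℝ) < n := by exact_mod_cast hlt
      rw [he]; push_cast at this ⊢; linarith
    · refine ih ?_ ?_
      · refine HasOrderLT.of_smul (neg_ne_zero.2 h0) ?_
        convert h1 using 1
        rw [smul_sub, smul_smul, neg_mul, mul_inv_cancel₀ h0]
        module
      · refine LinearMap.ext fun p => ?_
        have := LinearMap.congr_fun hcl p
        simp only [LinearMap.comp_apply, LinearMap.sub_apply, LinearMap.smul_apply, map_sub,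
          map_smul, hdd, smul_zero, sub_zero, LinearMap.zero_apply] at this ⊢
        exact this

/-- An exact operator of order zero in degree `n` vanishes. -/
theorem d_comp_eq_zero {i k : ℕ} (hi : i + 1 = n) {G : P →ₗ[ℝ] Ω i} (hG : HasOrderLT A k G)
    (h1 : HasOrderLT A 1 (d i ∘ₗ G)) : d i ∘ₗ G = 0 := by
  induction k generalizing G with
  | zero => rw [show G = 0 from hG, LinearMap.comp_zero]
  | succ k ih =>
    -- The operator `N G = h d G + d h G` satisfies `d N G = 0`, and `N G - (1 + k) G` has smaller
    -- order than `G`.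
    obtain ⟨N, hN, hord⟩ : ∃ N : P →ₗ[ℝ] Ω i, d i ∘ₗ N = 0 ∧
        HasOrderLT A k (N - ((1 : ℝ) + k) • G) := by
      rcases i with _ | i
      · refine ⟨H.h 0 (d 0 ∘ₗ G), ?_, ?_⟩
        · rw [H.h_of_order_one _ _ h1, LinearMap.comp_zero]
        · have := H.hasOrderLT_zero hd hG
          rwa [show (n : ℝ) = 1 by rw [← hi]; simp] at this
      · refine ⟨H.h (i + 1) (d (i + 1) ∘ₗ G) + d i ∘ₗ H.h i G, ?_, ?_⟩
        · rw [H.h_of_order_one _ _ h1, zero_add]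
          exact LinearMap.ext fun p => hdd i _
        · have := H.hasOrderLT_succ hd i hG
          rwa [show (n : ℝ) - (i + 1 : ℕ) = 1 by rw [← hi]; push_cast; ring] at this
    have h2 : d i ∘ₗ (N - ((1 : ℝ) + k) • G) = -((1 : ℝ) + k) • (d i ∘ₗ G) := by
      rw [LinearMap.comp_sub, hN, LinearMap.comp_smul, zero_sub, neg_smul]
    have h3 := ih hord (by rw [h2]; exact h1.smul _)
    rw [h2] at h3
    have h4 : -((1 : ℝ) + k) ≠ 0 := neg_ne_zero.2 (by positivity)
    exact (smul_eq_zero_iff_right h4).1 h3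

end EulerHomotopy

end EulerHomotopy

/-! ### Hadamard's lemma -/

section Hadamard

open MeasureTheory

/-- Integrals of smooth functions over a compact interval depend smoothly on parameters. -/
theorem contDiff_parametric_intervalIntegral {E : Type} [NormedAddCommGroup E] [NormedSpace ℝ E]
    [FiniteDimensional ℝ E] (m : ℕ) {W : Type} [NormedAddCommGroup W] [NormedSpace ℝ W]
    [CompleteSpace W] {f : E × ℝ → W} (hf : ContDiff ℝ ∞ f) :
    ContDiff ℝ m (fun y => ∫ t in (0 : ℝ)..1, f (y, t)) := by
  induction m generalizing W with
  | zero =>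
    rw [Nat.cast_zero, contDiff_zero]
    exact intervalIntegral.continuous_parametric_intervalIntegral_of_continuous'
      (f := fun y t => f (y, t)) (by simpa [Function.uncurry_def] using hf.continuous) 0 1
  | succ m ih =>
    rw [Nat.cast_add, Nat.cast_one, contDiff_succ_iff_hasFDerivAt]
    set f' : E × ℝ → E →L[ℝ] W := fun q => (fderiv ℝ f q).comp (ContinuousLinearMap.inl ℝ E ℝ)
      with hf'
    have hsm : ContDiff ℝ ∞ f' :=
      (hf.fderiv_right (m := ∞) (by simp)).clm_comp contDiff_const
    refine ⟨fun y => ∫ t in (0 : ℝ)..1, f' (y, t), ih hsm, fun y => ?_⟩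
    have hcomp : IsCompact (Metric.closedBall y 1 ×ˢ Set.Icc (0 : ℝ) 1) :=
      (isCompact_closedBall y 1).prod isCompact_Icc
    obtain ⟨C, hC⟩ := hcomp.exists_bound_of_continuousOn hsm.continuous.continuousOn
    refine intervalIntegral.hasFDerivAt_integral_of_dominated_of_fderiv_le
      (F := fun y t => f (y, t)) (F' := fun y t => f' (y, t)) (bound := fun _ => C)
      (Metric.closedBall_mem_nhds y one_pos) ?_ ?_ ?_ ?_ ?_ ?_
    · exact .of_forall fun z =>
        (hf.continuous.comp (by fun_prop : Continuous fun t : ℝ => (z, t))).aestronglyMeasurable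
    · exact (hf.continuous.comp
        (by fun_prop : Continuous fun t : ℝ => (y, t))).intervalIntegrable 0 1
    · exact (hsm.continuous.comp
        (by fun_prop : Continuous fun t : ℝ => (y, t))).aestronglyMeasurable
    · refine .of_forall fun t ht z hz => hC _ ⟨hz, ?_⟩
      rw [Set.uIoc_of_le zero_le_one] at ht
      exact ⟨ht.1.le, ht.2⟩
    · exact intervalIntegrable_const
    · refine .of_forall fun t _ z _ => ?_
      have h1 : HasFDerivAt f (fderiv ℝ f (z, t)) (z, t) :=
        (hf.differentiable (by simp)).differentiableAt.hasFDerivAt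
      exact h1.comp z (hasFDerivAt_prodMk_left z t)

/-- **Hadamard's lemma**: a smooth function is its value at a point plus a smooth family of linear
forms evaluated at the displacement; the linear form at the point is the derivative. -/
theorem hadamard_lemma {E : Type} [NormedAddCommGroup E] [NormedSpace ℝ E] [FiniteDimensional ℝ E]
    {g : E → ℝ} (hg : ContDiff ℝ ∞ g) (y₀ : E) :
    ∃ θ : E → E →L[ℝ] ℝ, ContDiff ℝ ∞ θ ∧ θ y₀ = fderiv ℝ g y₀ ∧
      ∀ y, g y = g y₀ + θ y (y - y₀) := by
  set f : E × ℝ → E →L[ℝ] ℝ := fun q => fderiv ℝ g (y₀ + q.2 • (q.1 - y₀)) with hf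
  have hsm : ContDiff ℝ ∞ f := by
    have h1 : ContDiff ℝ ∞ (fun q : E × ℝ => y₀ + q.2 • (q.1 - y₀)) := by fun_prop
    exact (hg.fderiv_right (m := ∞) (by simp)).comp h1
  refine ⟨fun y => ∫ t in (0 : ℝ)..1, f (y, t), ?_, by simp [hf], fun y => ?_⟩
  · exact contDiff_infty.2 fun m => contDiff_parametric_intervalIntegral m hsm
  · have hint : IntervalIntegrable (fun t => f (y, t)) volume 0 1 :=
      (hsm.continuous.comp (by fun_prop : Continuous fun t : ℝ => (y, t))).intervalIntegrable 0 1
    have h2 : (∫ t in (0 : ℝ)..1, f (y, t)) (y - y₀) = ∫ t in (0 : ℝ)..1, f (y, t) (y - y₀) :=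
      ContinuousLinearMap.intervalIntegral_apply hint _
    rw [h2, intervalIntegral.integral_eq_sub_of_hasDerivAt
      (f := fun t : ℝ => g (y₀ + t • (y - y₀)))]
    · simp
    · intro t _
      have h3 : HasFDerivAt g (fderiv ℝ g (y₀ + t • (y - y₀))) (y₀ + t • (y - y₀)) :=
        (hg.differentiable (by simp)).differentiableAt.hasFDerivAt
      have h4 : HasDerivAt (fun t : ℝ => y₀ + t • (y - y₀)) (y - y₀) t := by
        simpa using ((hasDerivAt_id t).smul_const (y - y₀)).const_add y₀
      exact h3.comp_hasDerivAt t h4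
    · exact ((hsm.continuous.comp (by fun_prop : Continuous fun t : ℝ => (y, t))).clm_apply
        continuous_const).intervalIntegrable 0 1

end Hadamard

/-! ### Exterior multiplication and contraction -/

section Contraction

variable {E : Type*} [NormedAddCommGroup E] [NormedSpace ℝ E]

/-- The exterior product `θ ∧ w` of a linear form with an alternating form. -/
noncomputable def wedge {k : ℕ} (θ : E →L[ℝ] ℝ) (w : E [⋀^Fin k]→L[ℝ] ℝ) :
    E [⋀^Fin (k + 1)]→L[ℝ] ℝ :=
  ContinuousAlternatingMap.alternatizeUncurryFin (θ.smulRight w)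

theorem wedge_apply {k : ℕ} (θ : E →L[ℝ] ℝ) (w : E [⋀^Fin k]→L[ℝ] ℝ) (v : Fin (k + 1) → E) :
    wedge θ w v = ∑ i : Fin (k + 1), (-1) ^ (i : ℕ) * (θ (v i) * w (i.removeNth v)) := by
  simp [wedge, ContinuousAlternatingMap.alternatizeUncurryFin_apply]

theorem wedge_sum {ι : Type*} (S : Finset ι) {k : ℕ} (θ : E →L[ℝ] ℝ)
    (w : ι → E [⋀^Fin k]→L[ℝ] ℝ) : wedge θ (∑ j ∈ S, w j) = ∑ j ∈ S, wedge θ (w j) := by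
  ext v
  simp only [wedge_apply, ContinuousAlternatingMap.sum_apply, Finset.mul_sum]
  exact Finset.sum_comm

theorem wedge_smul {k : ℕ} (θ : E →L[ℝ] ℝ) (c : ℝ) (w : E [⋀^Fin k]→L[ℝ] ℝ) :
    wedge θ (c • w) = c • wedge θ w := by
  ext v
  simp only [wedge_apply, ContinuousAlternatingMap.smul_apply, smul_eq_mul, Finset.mul_sum]
  exact Finset.sum_congr rfl fun _ _ => by ring

theorem curryLeft_wedge_zero (θ : E →L[ℝ] ℝ) (w : E [⋀^Fin 0]→L[ℝ] ℝ) (v : E) :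
    (wedge θ w).curryLeft v = θ v • w := by
  ext u
  simp [wedge_apply]

/-- Contraction is an antiderivation. -/
theorem curryLeft_wedge {k : ℕ} (θ : E →L[ℝ] ℝ) (w : E [⋀^Fin (k + 1)]→L[ℝ] ℝ) (v : E) :
    (wedge θ w).curryLeft v + wedge θ (w.curryLeft v) = θ v • w := by
  ext u
  simp only [ContinuousAlternatingMap.add_apply, ContinuousAlternatingMap.curryLeft_apply_apply,
    wedge_apply, ContinuousAlternatingMap.smul_apply, smul_eq_mul]
  rw [Fin.sum_univ_succ]
  simp only [Fin.val_zero, pow_zero, one_mul, Matrix.cons_val_zero, Matrix.cons_val_succ,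
    Fin.val_succ, Fin.removeNth_zero]
  rw [add_assoc, ← Finset.sum_add_distrib]
  have h : ∀ i : Fin (k + 1), Fin.removeNth i.succ (Matrix.vecCons v u) =
      Matrix.vecCons v (i.removeNth u) := by
    intro i
    funext j
    refine Fin.cases ?_ (fun j => ?_) j
    · simp [Fin.removeNth]
    · simp [Fin.removeNth]
  simp only [h, pow_succ]
  simp

/-- If `∑ θ_j ⊗ u_j` is the identity and `θ_j (u_j) = 1` for all `j = 1, …, n`, then
`∑ ι_{u_j} (θ_j ∧ w) = (n - k) w` for a `k`-form `w`. -/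
theorem sum_curryLeft_wedge {n k : ℕ} {θ : Fin n → E →L[ℝ] ℝ} {u : Fin n → E}
    (h1 : ∀ j, θ j (u j) = 1) (hid : ∀ v, ∑ j, θ j v • u j = v) (w : E [⋀^Fin k]→L[ℝ] ℝ) :
    ∑ j, (wedge (θ j) w).curryLeft (u j) = ((n : ℝ) - k) • w := by
  rcases k with _ | k
  · simp [curryLeft_wedge_zero, h1, ← Nat.cast_smul_eq_nsmul ℝ]
  · have h2 : ∀ j, (wedge (θ j) w).curryLeft (u j) = w - wedge (θ j) (w.curryLeft (u j)) := by
      intro j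
      rw [eq_sub_iff_add_eq, curryLeft_wedge, h1, one_smul]
    have h3 : ∑ j, wedge (θ j) (w.curryLeft (u j)) = ((k : ℝ) + 1) • w := by
      have h4 : w.curryLeft = ∑ j, (θ j).smulRight (w.curryLeft (u j)) := by
        refine ContinuousLinearMap.ext fun v => ?_
        conv_lhs => rw [← hid v]
        simp
      have h5 := ContinuousAlternatingMap.alternatizeUncurryFin_curryLeft w
      rw [h4, ← ContinuousAlternatingMap.alternatizeUncurryFinCLM_apply, map_sum] at h5
      rw [← Nat.cast_smul_eq_nsmul ℝ] at h5
      push_cast at h5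
      exact h5
    simp only [h2, Finset.sum_sub_distrib, h3, Finset.sum_const, Finset.card_univ, Fintype.card_fin,
      ← Nat.cast_smul_eq_nsmul ℝ, Nat.cast_add, Nat.cast_one]
    exact (sub_smul _ _ _).symm

end Contraction

/-! ### Forms, derivatives and coordinate fields at a point -/

section Pointwise

variable {n : ℕ} {X : Type*} [TopologicalSpace X] [ChartedSpace (Model n) X] {k : ℕ}

/-- The value of a form at a point, as an alternating form on `ℝⁿ`: the tangent space at `x` is
identified with `ℝⁿ` by means of the preferred chart at `x`. -/
def DiffForm.val (η : DiffForm n X k) (x : X) : Model n [⋀^Fin k]→L[ℝ] ℝ := η.1 x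

theorem DiffForm.ext_val {η θ : DiffForm n X k} (h : ∀ x, η.val x = θ.val x) : η = θ :=
  Subtype.ext (funext h)

@[simp] theorem DiffForm.val_add (η θ : DiffForm n X k) (x : X) :
    (η + θ).val x = η.val x + θ.val x := rfl

@[simp] theorem DiffForm.val_sub (η θ : DiffForm n X k) (x : X) :
    (η - θ).val x = η.val x - θ.val x := rfl

@[simp] theorem DiffForm.val_smul (c : ℝ) (η : DiffForm n X k) (x : X) :
    (c • η).val x = c • η.val x := rfl

/-- The value of a form at a point, as a linear map. -/
def DiffForm.valₗ (x : X) : DiffForm n X k →ₗ[ℝ] (Model n [⋀^Fin k]→L[ℝ] ℝ) where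
  toFun η := η.val x
  map_add' _ _ := rfl
  map_smul' _ _ := rfl

/-- The derivative of the inverse of the chart at `c`, with tangent spaces identified with `ℝⁿ`. -/
noncomputable def chartSymmDeriv (c : X) (y : Model n) : Model n →L[ℝ] Model n :=
  mfderiv 𝓘(ℝ, Model n) (𝓡 n) (extChartAt (𝓡 n) c).symm y

theorem chartRep_eq (η : ∀ x : X, FormAt n k x) (c : X) (y : Model n) :
    chartRep η c y = ContinuousAlternatingMap.compContinuousLinearMap
      (show Model n [⋀^Fin k]→L[ℝ] ℝ from η ((extChartAt (𝓡 n) c).symm y))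
      (chartSymmDeriv c y) := rfl

/-- The derivative of a function at a point, in the preferred chart at the point. -/
noncomputable def dAt (g : X → ℝ) (x : X) : Model n →L[ℝ] ℝ :=
  fderiv ℝ (fun y => g ((extChartAt (𝓡 n) x).symm y)) (extChartAt (𝓡 n) x x)

/-- At the point `x`, the constant vector fields in the chart at `c`. -/
noncomputable def coordVec (c x : X) : Model n →L[ℝ] Model n :=
  fderiv ℝ (extChartAt (𝓡 n) x ∘ (extChartAt (𝓡 n) c).symm) (extChartAt (𝓡 n) c x)

theorem dAt_congr {f g : X → ℝ} {x : X} (h : f =ᶠ[𝓝 x] g) :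
    (dAt f x : Model n →L[ℝ] ℝ) = dAt g x := by
  refine Filter.EventuallyEq.fderiv_eq ?_
  have hcont : ContinuousAt (extChartAt (𝓡 n) x).symm (extChartAt (𝓡 n) x x) :=
    continuousAt_extChartAt_symm x
  have h' : ∀ᶠ z in 𝓝 ((extChartAt (𝓡 n) x).symm (extChartAt (𝓡 n) x x)), f z = g z := by
    rwa [extChartAt_to_inv]
  exact hcont.eventually h'

variable [IsManifold (𝓡 n) ∞ X]

@[simp] theorem DiffForm.val_funSmul (f : SmoothFun n X) (η : DiffForm n X k) (x : X) :
    (f • η).val x = f x • η.val x := rfl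

theorem chartSymmDeriv_self (x : X) :
    chartSymmDeriv x (extChartAt (𝓡 n) x x) = ContinuousLinearMap.id ℝ (Model n) := by
  have : IsManifold (𝓡 n) 1 X := IsManifold.of_le (n := ∞) (by simp)
  have h := mfderivWithin_range_extChartAt_symm (I := 𝓡 n) (x := x)
  rw [ModelWithCorners.range_eq_univ, mfderivWithin_univ] at h
  exact h

theorem chartSymmDeriv_change {c c' x : X} (hc : x ∈ (extChartAt (𝓡 n) c).source)
    (hc' : x ∈ (extChartAt (𝓡 n) c').source) (v : Model n) :
    chartSymmDeriv c (extChartAt (𝓡 n) c x) v =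
      chartSymmDeriv c' (extChartAt (𝓡 n) c' x)
        (fderiv ℝ (extChartAt (𝓡 n) c' ∘ (extChartAt (𝓡 n) c).symm) (extChartAt (𝓡 n) c x) v) := by
  have hl := (extChartAt (𝓡 n) c).left_inv hc
  have h := (mfderiv_extChartAt_symm_comp (n := n) c c' ((extChartAt (𝓡 n) c).map_source hc)
    (by rwa [hl])).2 v
  have h' : chartSymmDeriv c (extChartAt (𝓡 n) c x) v = chartSymmDeriv c'
      (extChartAt (𝓡 n) c' ((extChartAt (𝓡 n) c).symm (extChartAt (𝓡 n) c x)))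
        (fderiv ℝ (extChartAt (𝓡 n) c' ∘ (extChartAt (𝓡 n) c).symm) (extChartAt (𝓡 n) c x) v) := h
  rwa [hl] at h'

theorem chartSymmDeriv_eq_coordVec {c x : X} (hc : x ∈ (extChartAt (𝓡 n) c).source) :
    chartSymmDeriv c (extChartAt (𝓡 n) c x) = coordVec c x := by
  ext1 v
  rw [chartSymmDeriv_change hc (mem_extChartAt_source x), chartSymmDeriv_self]
  rfl

theorem chartRep_self (η : DiffForm n X k) (x : X) :
    chartRep η.1 x (extChartAt (𝓡 n) x x) = η.val x := by
  rw [chartRep_eq, chartSymmDeriv_self]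
  have h : ∀ z : X, z = x → (show Model n [⋀^Fin k]→L[ℝ] ℝ from η.1 z) = η.val x := by
    rintro z rfl; rfl
  rw [h _ (extChartAt_to_inv x)]
  ext v
  rfl

/-- `[d, g] η = dg ∧ η` pointwise. -/
theorem val_commutator_deRham (g : SmoothFun n X) (η : DiffForm n X k) (x : X) :
    (commutator (deRham n X k) g η).val x = wedge (dAt g x) (η.val x) := by
  have : IsManifold (𝓡 n) 1 X := IsManifold.of_le (n := ∞) (by simp)
  have h := commutator_deRham g η x
  rw [chartRep_self, mfderiv_extChartAt_self] at h
  refine h.trans ?_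
  ext v
  rfl

theorem transition_fderiv_comp {c x : X} (hc : x ∈ (extChartAt (𝓡 n) c).source) :
    (fderiv ℝ (extChartAt (𝓡 n) c ∘ (extChartAt (𝓡 n) x).symm) (extChartAt (𝓡 n) x x)) ∘L
      coordVec c x = ContinuousLinearMap.id ℝ (Model n) ∧
    coordVec c x ∘L (fderiv ℝ (extChartAt (𝓡 n) c ∘ (extChartAt (𝓡 n) x).symm)
      (extChartAt (𝓡 n) x x)) = ContinuousLinearMap.id ℝ (Model n) := by
  have hx := mem_extChartAt_source (I := 𝓡 n) x
  have hself : ∀ a b : X, x ∈ (extChartAt (𝓡 n) a).source → x ∈ (extChartAt (𝓡 n) b).source →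
      (fderiv ℝ (extChartAt (𝓡 n) b ∘ (extChartAt (𝓡 n) a).symm) (extChartAt (𝓡 n) a x)) ∘L
      (fderiv ℝ (extChartAt (𝓡 n) a ∘ (extChartAt (𝓡 n) b).symm) (extChartAt (𝓡 n) b x)) =
      ContinuousLinearMap.id ℝ (Model n) := by
    intro a b ha hb
    have hla := (extChartAt (𝓡 n) a).left_inv ha
    have hlb := (extChartAt (𝓡 n) b).left_inv hb
    have ha' := (extChartAt (𝓡 n) a).map_source ha
    have hb' := (extChartAt (𝓡 n) b).map_source hb
    have h1 := (mfderiv_extChartAt_symm_comp (n := n) a b ha' (by rwa [hla])).1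
    have h2 := (mfderiv_extChartAt_symm_comp (n := n) b a hb' (by rwa [hlb])).1
    have h3 : (extChartAt (𝓡 n) a ∘ (extChartAt (𝓡 n) b).symm) (extChartAt (𝓡 n) b x) =
        extChartAt (𝓡 n) a x := by rw [Function.comp_apply, hlb]
    rw [← h3] at h1 ⊢
    rw [← fderiv_comp _ (h1.differentiableAt (by simp)) (h2.differentiableAt (by simp))]
    have hev : (extChartAt (𝓡 n) b ∘ (extChartAt (𝓡 n) a).symm) ∘
        (extChartAt (𝓡 n) a ∘ (extChartAt (𝓡 n) b).symm) =ᶠ[𝓝 (extChartAt (𝓡 n) b x)] id := by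
      have hcont : ContinuousAt (extChartAt (𝓡 n) b).symm (extChartAt (𝓡 n) b x) :=
        continuousAt_extChartAt_symm'' hb'
      filter_upwards [(isOpen_extChartAt_target b).mem_nhds hb',
        hcont.preimage_mem_nhds ((isOpen_extChartAt_source a).mem_nhds (by rwa [hlb]))] with z hz hz'
      simp only [Function.comp_apply, id_eq]
      rw [(extChartAt (𝓡 n) a).left_inv hz', (extChartAt (𝓡 n) b).right_inv hz]
    rw [hev.fderiv_eq, fderiv_id]
  exact ⟨hself x c hx hc, hself c x hc hx⟩

theorem differentiableAt_comp_chart (g : SmoothFun n X) (x : X) :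
    DifferentiableAt ℝ (fun y => g ((extChartAt (𝓡 n) x).symm y)) (extChartAt (𝓡 n) x x) :=
  ((contDiffOn_comp_chart g x).contDiffAt ((isOpen_extChartAt_target x).mem_nhds
      (mem_extChartAt_target x))).differentiableAt (by simp)

/-- The derivative of smooth functions at a point, as a linear map. -/
noncomputable def dAtₗ (x : X) : SmoothFun n X →ₗ[ℝ] (Model n →L[ℝ] ℝ) where
  toFun g := dAt g x
  map_add' f g := fderiv_add (differentiableAt_comp_chart f x) (differentiableAt_comp_chart g x)
  map_smul' c f := fderiv_const_smul (differentiableAt_comp_chart f x) c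

/-- If the functions `f_j` agree near `x` with the coordinates of the chart at `c`, then the
differentials of the `f_j` and the coordinate vectors of this chart are dual bases at `x`. -/
theorem coordVec_dual {c x : X} (hc : x ∈ (extChartAt (𝓡 n) c).source) {f : Fin n → X → ℝ}
    (hf : ∀ j, f j =ᶠ[𝓝 x] fun z => extChartAt (𝓡 n) c z j) :
    (∀ j, dAt (f j) x (coordVec c x (EuclideanSpace.single j 1)) = 1) ∧
    ∀ v, ∑ j, dAt (f j) x v • coordVec c x (EuclideanSpace.single j 1) = v := by
  have hx := mem_extChartAt_source (I := 𝓡 n) x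
  set B := fderiv ℝ (extChartAt (𝓡 n) c ∘ (extChartAt (𝓡 n) x).symm) (extChartAt (𝓡 n) x x)
    with hB
  obtain ⟨h1, h2⟩ := transition_fderiv_comp hc
  have hd : ∀ j v, dAt (f j) x v = B v j := by
    intro j v
    rw [dAt_congr (hf j)]
    have hdiff := (mfderiv_extChartAt_symm_comp (n := n) x c
      ((extChartAt (𝓡 n) x).map_source hx) (by rwa [extChartAt_to_inv])).1.differentiableAt
      (by simp)
    have h3 := ((EuclideanSpace.proj j : Model n →L[ℝ] ℝ).hasFDerivAt.comp _
      hdiff.hasFDerivAt).fderiv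
    exact congrArg (fun L : Model n →L[ℝ] ℝ => L v) h3
  refine ⟨fun j => ?_, fun v => ?_⟩
  · rw [hd]
    have := congrArg (fun L : Model n →L[ℝ] Model n => L (EuclideanSpace.single j 1) j) h1
    simpa [hB] using this
  · simp only [hd]
    have h3 : ∑ j, B v j • (EuclideanSpace.single j (1 : ℝ) : Model n) = B v := by
      ext i
      simp [Finset.sum_apply, Pi.single_apply]
    have h4 : coordVec c x (B v) = v := congrArg (fun L : Model n →L[ℝ] Model n => L v) h2
    conv_rhs => rw [← h4, ← h3]
    simp

end Pointwise

/-! ### Cutoff functions and operators of first order -/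

section Cutoff

variable {n : ℕ} {X : Type*} [TopologicalSpace X] [ChartedSpace (Model n) X]

theorem exists_smoothFun_cutoff_mul {χ : SmoothFun n X} {U : Set X} (hU : IsOpen U)
    (hχ : tsupport χ ⊆ U) {g : X → ℝ} (hg : ContMDiffOn (𝓡 n) 𝓘(ℝ) ∞ g U) :
    ∃ f : SmoothFun n X, ∀ x, f x = χ x * g x := by
  refine ⟨⟨fun x => χ x * g x, contMDiff_of_tsupport fun x hx => ?_⟩, fun x => rfl⟩
  have hx' : x ∈ tsupport χ := tsupport_mul_subset_left hx
  exact χ.contMDiff.contMDiffAt.mul (hg.contMDiffAt (hU.mem_nhds (hχ hx')))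

variable [IsManifold (𝓡 n) ∞ X]

theorem exists_cutoff [T2Space X] {x : X} {U : Set X} (hU : U ∈ 𝓝 x) :
    ∃ χ : SmoothFun n X, (∀ᶠ z in 𝓝 x, χ z = 1) ∧ tsupport χ ⊆ U := by
  obtain ⟨b, -, hb⟩ := (SmoothBumpFunction.nhds_basis_tsupport (I := 𝓡 n) x).mem_iff.1 hU
  exact ⟨⟨b, b.contMDiff⟩, b.eventuallyEq_one, hb⟩

theorem exists_cutoff_of_isClosed [T2Space X] [SigmaCompactSpace X] {S U : Set X}
    (hS : IsClosed S) (hU : IsOpen U) (hSU : S ⊆ U) :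
    ∃ χ : SmoothFun n X, (∀ x ∈ S, ∀ᶠ z in 𝓝 x, χ z = 1) ∧ tsupport χ ⊆ U := by
  have : LocallyCompactSpace X := ChartedSpace.locallyCompactSpace (Model n) X
  obtain ⟨T, hT, hST, hTU⟩ := normal_exists_closure_subset hS hU hSU
  obtain ⟨χ, h1, h0, -⟩ := exists_contMDiffMap_one_nhds_of_subset_interior (𝓡 n) (n := ⊤) hS
    (t := closure T) (hST.trans (hT.subset_interior_iff.2 subset_closure))
  refine ⟨χ, fun x hx => Filter.eventually_iff.2 ?_, (closure_minimal ?_ isClosed_closure).trans hTU⟩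
  · exact (mem_nhdsSet_iff_forall.1 (Filter.eventually_iff.1 h1)) x hx
  · exact fun x hx => by_contra fun hx' => hx (h0 x hx')

variable {P : Type*} [AddCommGroup P] [Module ℝ P] [Module (SmoothFun n X) P]
  [IsScalarTower ℝ (SmoothFun n X) P] {k : ℕ}

/-- An operator of order `≤ 1` acts as a derivation on functions. -/
theorem commutator_mul_of_order_two {A : Type*} [CommRing A] [Algebra ℝ A]
    {P : Type*} [AddCommGroup P] [Module ℝ P] [Module A P] [IsScalarTower ℝ A P]
    {Q : Type*} [AddCommGroup Q] [Module ℝ Q] [Module A Q] [IsScalarTower ℝ A Q]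
    {Δ : P →ₗ[ℝ] Q} (hΔ : HasOrderLT A 2 Δ) (f g : A) (p : P) :
    commutator Δ (f * g) p = f • commutator Δ g p + g • commutator Δ f p := by
  have h := HasOrderLT.map_smul (hΔ f) g p
  rw [← h]
  simp only [commutator_apply, smul_sub, smul_smul]
  abel

/-- The commutator of a function with an operator of order `≤ 1` depends, at a point, only on the
differential of the function: by Hadamard's lemma, a function with vanishing differential is, up to
a constant and near the point, a sum of products of functions that vanish at the point. -/
theorem val_commutator_eq_zero [T2Space X] {Δ : P →ₗ[ℝ] DiffForm n X k}
    (hΔ : HasOrderLT (SmoothFun n X) 2 Δ) {g : SmoothFun n X} {x : X}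
    (hg : (dAt g x : Model n →L[ℝ] ℝ) = 0) (s : P) : (commutator Δ g s).val x = 0 := by
  -- `D g` is the value of `[Δ, g] s` at `x`; it is linear, a derivation, and local.
  set D : SmoothFun n X →ₗ[ℝ] (Model n [⋀^Fin k]→L[ℝ] ℝ) :=
    { toFun := fun g => (commutator Δ g s).val x
      map_add' := fun f g => by
        rw [← DiffForm.val_add]
        congr 1
        simp only [commutator_apply, add_smul, map_add]
        abel
      map_smul' := fun c f => by
        rw [RingHom.id_apply, ← DiffForm.val_smul]
        congr 1
        simp only [commutator_apply, smul_assoc, map_smul, smul_sub] } with hD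
  have hmul : ∀ f g, D (f * g) = f x • D g + g x • D f := fun f g => by
    change (commutator Δ (f * g) s).val x = _
    rw [commutator_mul_of_order_two hΔ]; rfl
  have hone : D 1 = 0 := by
    have := hmul 1 1
    rw [mul_one] at this
    have h1 : (1 : SmoothFun n X) x = 1 := rfl
    rw [h1, one_smul] at this
    simpa using this
  have hloc : ∀ f : SmoothFun n X, (∀ᶠ z in 𝓝 x, f z = 0) → D f = 0 := by
    intro f hf
    obtain ⟨χ, h1, hχ⟩ := exists_cutoff (n := n) hf
    have h0 : χ * f = 0 := by
      ext z
      change χ z * f z = 0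
      by_cases hz : z ∈ tsupport χ
      · rw [hχ hz, mul_zero]
      · rw [image_eq_zero_of_notMem_tsupport hz, zero_mul]
    have := hmul χ f
    rw [h0, map_zero, h1.self_of_nhds, hf.self_of_nhds, one_smul, zero_smul, add_zero] at this
    exact this.symm
  -- Extend the expression of `g` in the chart at `x` to a smooth function on `ℝⁿ`.
  set φ := extChartAt (𝓡 n) x with hφ
  have hxt : φ x ∈ φ.target := mem_extChartAt_target x
  obtain ⟨ε, hε, hball⟩ := Metric.isOpen_iff.1 (isOpen_extChartAt_target (I := 𝓡 n) x) _ hxt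
  let b : ContDiffBump (φ x) := ⟨ε / 4, ε / 2, by positivity, by linarith⟩
  have hbt : tsupport b ⊆ φ.target := by
    rw [b.tsupport_eq]
    exact (Metric.closedBall_subset_ball (by change ε / 2 < ε; linarith)).trans hball
  have hG : ContDiff ℝ ∞ (fun y => b y * g (φ.symm y)) := by
    rw [← contMDiff_iff_contDiff]
    refine contMDiff_of_tsupport fun y hy => ?_
    have hy' : y ∈ tsupport b := tsupport_mul_subset_left hy
    exact (b.contDiff.contDiffAt.mul ((contDiffOn_comp_chart g x).contDiffAt
      ((isOpen_extChartAt_target x).mem_nhds (hbt hy')))).contMDiffAt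
  obtain ⟨θ, hθ, hθ0, hθe⟩ := hadamard_lemma hG (φ x)
  have hGev : (fun y => b y * g (φ.symm y)) =ᶠ[𝓝 (φ x)] fun y => g (φ.symm y) := by
    filter_upwards [b.eventuallyEq_one] with y hy
    rw [hy, Pi.one_apply, one_mul]
  rw [hGev.fderiv_eq] at hθ0
  replace hθ0 : θ (φ x) = 0 := hθ0.trans hg
  -- Transport the factors back to `X`.
  obtain ⟨χ, hχ1, hχ⟩ := exists_cutoff (n := n) (extChartAt_source_mem_nhds (I := 𝓡 n) x)
  have hφsm : ContMDiffOn (𝓡 n) 𝓘(ℝ, Model n) ∞ φ φ.source := by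
    rw [hφ, extChartAt_source]; exact contMDiffOn_extChartAt
  have hopen := isOpen_extChartAt_source (I := 𝓡 n) x
  have hp : ∀ j : Fin n, ∃ p : SmoothFun n X, ∀ z, p z = χ z * (φ z - φ x) j := fun j => by
    refine exists_smoothFun_cutoff_mul hopen hχ ?_
    have h1 : ContDiff ℝ ∞ fun y : Model n => (y - φ x) j := by fun_prop
    exact h1.contMDiff.comp_contMDiffOn hφsm
  have hq : ∀ j : Fin n, ∃ q : SmoothFun n X, ∀ z, q z =
      χ z * θ (φ z) (EuclideanSpace.single j 1) := fun j => by
    refine exists_smoothFun_cutoff_mul hopen hχ ?_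
    have h1 : ContDiff ℝ ∞ fun y : Model n => θ y (EuclideanSpace.single j 1) :=
      hθ.clm_apply contDiff_const
    exact h1.contMDiff.comp_contMDiffOn hφsm
  choose p hp using hp
  choose q hq using hq
  have hcomb : D (g - (g x) • 1 - ∑ j, p j * q j) = 0 := by
    refine hloc _ ?_
    have hcont : ContinuousAt φ x := continuousAt_extChartAt x
    filter_upwards [hχ1, hcont.eventually hGev, extChartAt_source_mem_nhds (I := 𝓡 n) x]
      with z h1 h2 h3
    have hz : φ.symm (φ z) = z := φ.left_inv h3
    have h4 := hθe (φ z)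
    rw [h2, b.eventuallyEq_one.self_of_nhds, Pi.one_apply, one_mul, hz, extChartAt_to_inv] at h4
    have h5 : ∀ v : Model n, θ (φ z) v = ∑ j, v j * θ (φ z) (EuclideanSpace.single j 1) := by
      intro v
      have hv : v = ∑ j, v j • (EuclideanSpace.single j (1 : ℝ) : Model n) := by
        ext i; simp [Pi.single_apply]
      conv_lhs => rw [hv]
      simp
    have h6 : (∑ j, p j * q j : SmoothFun n X) z = ∑ j, p j z * q j z := by
      have := congrFun (map_sum (ContMDiffMap.coeFnAddMonoidHom (I := 𝓡 n) (N := X) (G := ℝ)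
        (I' := 𝓘(ℝ)) (n := ∞)) (fun j => p j * q j) Finset.univ) z
      simpa using this
    change g z - g x * 1 - (∑ j, p j * q j : SmoothFun n X) z = 0
    rw [h6, h4, h5]
    simp [hp, hq, h1]
  have hpq : ∀ j, D (p j * q j) = 0 := by
    intro j
    rw [hmul, hp, hq, hθ0]
    simp
  rw [map_sub, map_sub, map_sum, map_smul, hone, Finset.sum_eq_zero fun j _ => hpq j, smul_zero,
    sub_zero, sub_zero] at hcomb
  exact hcomb

end Cutoff

/-! ### The homotopy operator on a manifold -/

section ContractSum

variable {n : ℕ} {X : Type*} [TopologicalSpace X] [ChartedSpace (Model n) X]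
  [IsManifold (𝓡 n) ∞ X] {k : ℕ}

/-- The expression in the chart at `x₀` of a form given by its values under the identification of
the tangent spaces with `ℝⁿ`. -/
noncomputable def modelRep (W : X → Model n [⋀^Fin k]→L[ℝ] ℝ) (x₀ : X) (y : Model n) :
    Model n [⋀^Fin k]→L[ℝ] ℝ :=
  (W ((extChartAt (𝓡 n) x₀).symm y)).compContinuousLinearMap (chartSymmDeriv x₀ y)

/-- The contraction of a smooth form with a coordinate vector field of the chart at `c` is smooth on
the domain of this chart. -/
theorem contDiffAt_modelRep_curryLeft (η : DiffForm n X (k + 1)) (c x₀ : X) (v : Model n)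
    {y : Model n} (hy : y ∈ (extChartAt (𝓡 n) x₀).target)
    (hc : (extChartAt (𝓡 n) x₀).symm y ∈ (extChartAt (𝓡 n) c).source) :
    ContDiffAt ℝ ∞ (modelRep (fun x : X => (η.val x).curryLeft (coordVec c x v)) x₀) y := by
  -- In the chart at `x₀` the field is the image of a constant one under the transition map.
  set w : Model n → Model n := fun z =>
    fderiv ℝ (extChartAt (𝓡 n) x₀ ∘ (extChartAt (𝓡 n) c).symm)
      ((extChartAt (𝓡 n) c ∘ (extChartAt (𝓡 n) x₀).symm) z) v with hw
  have hsymm : ContinuousAt (extChartAt (𝓡 n) x₀).symm y := continuousAt_extChartAt_symm'' hy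
  have hev : modelRep (fun x : X => (η.val x).curryLeft (coordVec c x v)) x₀ =ᶠ[𝓝 y]
      fun z => (chartRep η.1 x₀ z).curryLeft (w z) := by
    filter_upwards [(isOpen_extChartAt_target x₀).mem_nhds hy,
      hsymm.preimage_mem_nhds ((isOpen_extChartAt_source c).mem_nhds hc)] with z hz hz'
    have hs := (extChartAt (𝓡 n) x₀).map_target hz
    have h1 := chartSymmDeriv_change hz' hs v
    rw [chartSymmDeriv_eq_coordVec hz', (extChartAt (𝓡 n) x₀).right_inv hz] at h1
    have h2 : coordVec c ((extChartAt (𝓡 n) x₀).symm z) v = chartSymmDeriv x₀ z (w z) := h1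
    have h3 := ContinuousAlternatingMap.curryLeft_compContinuousLinearMap
      (η.val ((extChartAt (𝓡 n) x₀).symm z)) (chartSymmDeriv x₀ z) (w z)
    rw [← h2] at h3
    exact h3.symm
  refine ContDiffAt.congr_of_eventuallyEq ?_ hev
  have h4 := (mfderiv_extChartAt_symm_comp (n := n) x₀ c hy hc).1
  have h5 : ContDiffAt ℝ ∞ (extChartAt (𝓡 n) x₀ ∘ (extChartAt (𝓡 n) c).symm)
      ((extChartAt (𝓡 n) c ∘ (extChartAt (𝓡 n) x₀).symm) y) :=
    (mfderiv_extChartAt_symm_comp (n := n) c x₀ ((extChartAt (𝓡 n) c).map_source hc)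
      (by rw [(extChartAt (𝓡 n) c).left_inv hc]; exact (extChartAt (𝓡 n) x₀).map_target hy)).1
  have h6 : ContDiffAt ℝ ∞ w y :=
    ((h5.fderiv_right (m := ∞) (by simp)).comp y h4).clm_apply contDiffAt_const
  have h7 : ContDiffAt ℝ ∞ (chartRep η.1 x₀) y :=
    (η.2 x₀).contDiffAt ((isOpen_extChartAt_target x₀).mem_nhds hy)
  have h8 : ContDiffAt ℝ ∞ (fun z => (chartRep η.1 x₀ z).curryLeft) y := by
    have hL : IsBoundedLinearMap ℝ fun w : Model n [⋀^Fin (k + 1)]→L[ℝ] ℝ => w.curryLeft :=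
      IsLinearMap.with_bound ⟨ContinuousAlternatingMap.curryLeft_add,
        ContinuousAlternatingMap.curryLeft_smul⟩ 1 fun w => by
          rw [ContinuousAlternatingMap.norm_curryLeft, one_mul]
    have hC : ContDiff ℝ ∞ fun w : Model n [⋀^Fin (k + 1)]→L[ℝ] ℝ => w.curryLeft :=
      IsBoundedLinearMap.contDiff (E := Model n [⋀^Fin (k + 1)]→L[ℝ] ℝ)
        (F := Model n →L[ℝ] Model n [⋀^Fin k]→L[ℝ] ℝ) hL
    exact hC.contDiffAt.comp y h7
  exact h8.clm_apply h6

omit [IsManifold (𝓡 n) ∞ X] in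
theorem modelRep_sum_smul {ι : Type*} (S : X → Finset ι) (r : ι → X → ℝ)
    (Z : ι → X → Model n [⋀^Fin k]→L[ℝ] ℝ) (x₀ : X) (y : Model n) :
    modelRep (fun x => ∑ c ∈ S x, r c x • Z c x) x₀ y =
      ∑ c ∈ S ((extChartAt (𝓡 n) x₀).symm y), r c ((extChartAt (𝓡 n) x₀).symm y) •
        modelRep (Z c) x₀ y := by
  have h := map_sum (ContinuousAlternatingMap.compContinuousLinearMapₗ (R := ℝ) (N := ℝ) (ι := Fin k)
    (chartSymmDeriv x₀ y)) (fun c => r c ((extChartAt (𝓡 n) x₀).symm y) •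
      Z c ((extChartAt (𝓡 n) x₀).symm y)) (S ((extChartAt (𝓡 n) x₀).symm y))
  simp only [map_smul] at h
  exact h

/-- The form `∑_c ρ_c ∑_j ι_{∂_j^c} W_{c,j}`, where `∂_j^c` are the coordinate vector fields of the
chart at `c` and `ρ` is a partition of unity subordinate to the domains of the charts. -/
noncomputable def contractSum (ρ : SmoothPartitionOfUnity X (𝓡 n) X Set.univ)
    (hρ : ρ.IsSubordinate fun c => (chartAt (Model n) c).source)
    (W : X → Fin n → DiffForm n X (k + 1)) : DiffForm n X k :=
  ⟨fun x => ∑ c ∈ ρ.finsupport x, ρ c x •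
      ∑ j, ((W c j).val x).curryLeft (coordVec c x (EuclideanSpace.single j 1)), by
    intro x₀ y hy
    refine ContDiffAt.contDiffWithinAt ?_
    set x := (extChartAt (𝓡 n) x₀).symm y with hx
    have hsymm : ContinuousAt (extChartAt (𝓡 n) x₀).symm y := continuousAt_extChartAt_symm'' hy
    -- Near `x` the sum extends over the finite set of those `c` with `x` in the support of `ρ_c`.
    have hev : modelRep (fun x : X => ∑ c ∈ ρ.finsupport x, ρ c x •
        ∑ j, ((W c j).val x).curryLeft (coordVec c x (EuclideanSpace.single j 1))) x₀ =ᶠ[𝓝 y]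
        fun z => ∑ c ∈ ρ.fintsupport x, ρ c ((extChartAt (𝓡 n) x₀).symm z) • ∑ j,
          modelRep (fun x : X =>
            ((W c j).val x).curryLeft (coordVec c x (EuclideanSpace.single j 1))) x₀ z := by
      filter_upwards [hsymm.eventually (ρ.eventually_finsupport_subset x)] with z hz
      refine (modelRep_sum_smul _ _ _ x₀ z).trans ?_
      have hin : ∀ c, modelRep (fun x : X =>
          ∑ j, ((W c j).val x).curryLeft (coordVec c x (EuclideanSpace.single j 1))) x₀ z =
          ∑ j, modelRep (fun x : X =>
            ((W c j).val x).curryLeft (coordVec c x (EuclideanSpace.single j 1))) x₀ z := by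
        intro c
        simpa using modelRep_sum_smul (fun _ => Finset.univ) (fun _ _ => 1)
          (fun j (x : X) => ((W c j).val x).curryLeft (coordVec c x (EuclideanSpace.single j 1))) x₀ z
      simp only [hin]
      refine Finset.sum_subset hz fun c _ hc => ?_
      have h0 : ρ c ((extChartAt (𝓡 n) x₀).symm z) = 0 := by
        by_contra h
        exact hc ((ρ.mem_finsupport _).2 h)
      rw [h0, zero_smul]
    refine ContDiffAt.congr_of_eventuallyEq ?_ hev
    refine ContDiffAt.sum fun c hc => ?_
    have hcs : x ∈ (extChartAt (𝓡 n) c).source := by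
      rw [extChartAt_source]
      exact hρ c ((ρ.mem_fintsupport_iff x c).1 hc)
    have h1 : ContDiffAt ℝ ∞ (fun z => ρ c ((extChartAt (𝓡 n) x₀).symm z)) y :=
      (contDiffOn_comp_chart (ρ c) x₀).contDiffAt ((isOpen_extChartAt_target x₀).mem_nhds hy)
    have h2 : ContDiffAt ℝ ∞ (fun z => ∑ j, modelRep (fun x : X =>
            ((W c j).val x).curryLeft (coordVec c x (EuclideanSpace.single j 1))) x₀ z) y :=
      ContDiffAt.sum fun j _ => contDiffAt_modelRep_curryLeft _ c x₀ _ hy hcs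
    exact h1.smul h2⟩

theorem val_contractSum (ρ : SmoothPartitionOfUnity X (𝓡 n) X Set.univ)
    (hρ : ρ.IsSubordinate fun c => (chartAt (Model n) c).source)
    (W : X → Fin n → DiffForm n X (k + 1)) (x : X) :
    (contractSum ρ hρ W).val x = ∑ c ∈ ρ.finsupport x, ρ c x •
      ∑ j, ((W c j).val x).curryLeft (coordVec c x (EuclideanSpace.single j 1)) := rfl

theorem contractSum_add (ρ : SmoothPartitionOfUnity X (𝓡 n) X Set.univ)
    (hρ : ρ.IsSubordinate fun c => (chartAt (Model n) c).source)
    (W W' : X → Fin n → DiffForm n X (k + 1)) :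
    contractSum ρ hρ (fun c j => W c j + W' c j) = contractSum ρ hρ W + contractSum ρ hρ W' := by
  refine DiffForm.ext_val fun x => ?_
  rw [DiffForm.val_add]
  simp only [val_contractSum, DiffForm.val_add, ContinuousAlternatingMap.curryLeft_add,
    add_apply, Finset.sum_add_distrib, smul_add]

theorem contractSum_funSmul (ρ : SmoothPartitionOfUnity X (𝓡 n) X Set.univ)
    (hρ : ρ.IsSubordinate fun c => (chartAt (Model n) c).source) (f : SmoothFun n X)
    (W : X → Fin n → DiffForm n X (k + 1)) :
    contractSum ρ hρ (fun c j => f • W c j) = f • contractSum ρ hρ W := by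
  refine DiffForm.ext_val fun x => ?_
  rw [DiffForm.val_funSmul]
  simp only [val_contractSum, DiffForm.val_funSmul, ContinuousAlternatingMap.curryLeft_smul,
    smul_apply, Finset.smul_sum]
  exact Finset.sum_congr rfl fun c _ => Finset.sum_congr rfl fun j _ => smul_comm _ _ _

theorem contractSum_smul (ρ : SmoothPartitionOfUnity X (𝓡 n) X Set.univ)
    (hρ : ρ.IsSubordinate fun c => (chartAt (Model n) c).source) (r : ℝ)
    (W : X → Fin n → DiffForm n X (k + 1)) :
    contractSum ρ hρ (fun c j => r • W c j) = r • contractSum ρ hρ W := by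
  have h := contractSum_funSmul ρ hρ (algebraMap ℝ (SmoothFun n X) r) W
  simpa only [algebraMap_smul] using h

theorem contractSum_zero (ρ : SmoothPartitionOfUnity X (𝓡 n) X Set.univ)
    (hρ : ρ.IsSubordinate fun c => (chartAt (Model n) c).source) :
    contractSum ρ hρ (fun _ _ => (0 : DiffForm n X (k + 1))) = 0 := by
  have h := contractSum_smul ρ hρ 0 (fun _ _ => (0 : DiffForm n X (k + 1)))
  simpa only [zero_smul] using h

end ContractSum

section Homotopy

variable {n : ℕ} {X : Type*} [TopologicalSpace X] [ChartedSpace (Model n) X]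
  [IsManifold (𝓡 n) ∞ X]
  {P : Type*} [AddCommGroup P] [Module ℝ P] [Module (SmoothFun n X) P]
  [IsScalarTower ℝ (SmoothFun n X) P]

omit [IsManifold (𝓡 n) ∞ X] in
theorem eq_sum_smul_of_finsupport {k : ℕ} (ρ : SmoothPartitionOfUnity X (𝓡 n) X Set.univ) (x : X)
    {φ : X → Model n [⋀^Fin k]→L[ℝ] ℝ} {w : Model n [⋀^Fin k]→L[ℝ] ℝ}
    (h : ∀ c ∈ ρ.finsupport x, φ c = w) : ∑ c ∈ ρ.finsupport x, ρ c x • φ c = w := by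
  rw [Finset.sum_congr rfl fun c hc => by rw [h c hc], ← Finset.sum_smul,
    ρ.sum_finsupport x (Set.mem_univ x), one_smul]

variable (ρ : SmoothPartitionOfUnity X (𝓡 n) X Set.univ)
  (hρ : ρ.IsSubordinate fun c => (chartAt (Model n) c).source) (f : X → Fin n → SmoothFun n X)

/-- The operation `Δ ↦ ∑_c ρ_c ∑_j ι_{∂_j^c} ∘ [Δ, f_{c,j}]`. -/
noncomputable def contractOp (i : ℕ) :
    (P →ₗ[ℝ] DiffForm n X (i + 1)) →ₗ[ℝ] (P →ₗ[ℝ] DiffForm n X i) where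
  toFun Δ :=
    { toFun := fun s => contractSum ρ hρ fun c j => commutator Δ (f c j) s
      map_add' := fun s t => by simp only [map_add, contractSum_add]
      map_smul' := fun r s => by simp only [map_smul, contractSum_smul, RingHom.id_apply] }
  map_add' Δ Δ' := LinearMap.ext fun s => by
    simp only [commutator_add_left]
    exact contractSum_add ρ hρ _ _
  map_smul' r Δ := LinearMap.ext fun s => by
    simp only [commutator_smul_left]
    exact contractSum_smul ρ hρ _ _

theorem contractOp_apply (i : ℕ) (Δ : P →ₗ[ℝ] DiffForm n X (i + 1)) (s : P) :
    contractOp ρ hρ f i Δ s = contractSum ρ hρ fun c j => commutator Δ (f c j) s := rfl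

theorem contractOp_funSmul (i : ℕ) (g : SmoothFun n X) (Δ : P →ₗ[ℝ] DiffForm n X (i + 1)) :
    contractOp ρ hρ f i (g • Δ) = g • contractOp ρ hρ f i Δ := by
  refine LinearMap.ext fun s => ?_
  rw [LinearMap.smul_apply, contractOp_apply, contractOp_apply, ← contractSum_funSmul]
  refine congrArg (contractSum ρ hρ) (funext fun c => funext fun j => ?_)
  simp only [commutator_apply, LinearMap.smul_apply, smul_sub, smul_smul, mul_comm]

theorem commutator_contractOp (i : ℕ) (Δ : P →ₗ[ℝ] DiffForm n X (i + 1)) (g : SmoothFun n X) :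
    commutator (contractOp ρ hρ f i Δ) g = contractOp ρ hρ f i (commutator Δ g) := by
  refine LinearMap.ext fun s => ?_
  have h2 : ∀ c j, commutator Δ (f c j) (g • s) =
      commutator (commutator Δ g) (f c j) s + g • commutator Δ (f c j) s := fun c j => by
    rw [commutator_comm Δ g (f c j), commutator_apply (commutator Δ (f c j)), sub_add_cancel]
  rw [commutator_apply, contractOp_apply, contractOp_apply, contractOp_apply]
  simp only [h2]
  rw [contractSum_add, contractSum_funSmul, add_sub_cancel_right]

theorem contractOp_of_order_one (i : ℕ) (Δ : P →ₗ[ℝ] DiffForm n X (i + 1))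
    (hΔ : HasOrderLT (SmoothFun n X) 1 Δ) : contractOp ρ hρ f i Δ = 0 := by
  refine LinearMap.ext fun s => ?_
  have h : ∀ c j, commutator Δ (f c j) s = 0 := fun c j => LinearMap.congr_fun (hΔ (f c j)) s
  rw [contractOp_apply]
  simp only [h]
  exact contractSum_zero ρ hρ

variable {ρ f}
  (hf : ∀ c j, ∀ x ∈ tsupport (ρ c), f c j =ᶠ[𝓝 x] fun z => extChartAt (𝓡 n) c z j)
include hρ hf

theorem dual_of_mem_finsupport {x c : X} (hc : c ∈ ρ.finsupport x) :
    (∀ j, dAt (f c j) x (coordVec c x (EuclideanSpace.single j 1)) = 1) ∧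
      ∀ v, ∑ j, dAt (f c j) x v • coordVec c x (EuclideanSpace.single j 1) = v := by
  have hx : x ∈ tsupport (ρ c) := subset_closure ((ρ.mem_finsupport x).1 hc)
  refine coordVec_dual (c := c) ?_ (fun j => hf c j x hx)
  rw [extChartAt_source]
  exact hρ c hx

theorem sum_smul_val_commutator [T2Space X] {k : ℕ} {Δ : P →ₗ[ℝ] DiffForm n X k}
    (hΔ : HasOrderLT (SmoothFun n X) 2 Δ) (g : SmoothFun n X) (s : P) {x c : X}
    (hc : c ∈ ρ.finsupport x) :
    ∑ j, dAt g x (coordVec c x (EuclideanSpace.single j 1)) •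
      (commutator Δ (f c j) s).val x = (commutator Δ g s).val x := by
  obtain ⟨h1, h2⟩ := dual_of_mem_finsupport hρ hf hc
  set r : Fin n → ℝ := fun j => dAt g x (coordVec c x (EuclideanSpace.single j 1)) with hr
  -- The function `g - ∑ r_j f_{c,j}` has vanishing differential at `x`.
  have h3 : dAtₗ x (g - ∑ j, r j • f c j) = 0 := by
    rw [map_sub, map_sum, sub_eq_zero]
    simp only [map_smul]
    ext1 v
    change dAt g x v = (∑ j, r j • (dAt (f c j) x : Model n →L[ℝ] ℝ)) v
    conv_lhs => rw [← h2 v]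
    simp [hr, mul_comm]
  have h4 := val_commutator_eq_zero hΔ h3 s
  have h5 : commutator Δ (g - ∑ j, r j • f c j) s =
      commutator Δ g s - ∑ j, r j • commutator Δ (f c j) s := by
    simp only [commutator_apply, sub_smul, Finset.sum_smul, map_sub, map_sum, smul_assoc,
      map_smul, smul_sub, Finset.sum_sub_distrib]
    abel
  rw [h5, DiffForm.val_sub, sub_eq_zero] at h4
  rw [h4]
  change _ = DiffForm.valₗ x _
  rw [map_sum]
  rfl

theorem contractOp_deRham (i : ℕ) (Δ : P →ₗ[ℝ] DiffForm n X i)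
    (hΔ : HasOrderLT (SmoothFun n X) 1 Δ) :
    contractOp ρ hρ f i (deRham n X i ∘ₗ Δ) = ((n : ℝ) - i) • Δ := by
  refine LinearMap.ext fun s => DiffForm.ext_val fun x => ?_
  rw [contractOp_apply, val_contractSum]
  refine eq_sum_smul_of_finsupport ρ x fun c hc => ?_
  obtain ⟨h1, h2⟩ := dual_of_mem_finsupport hρ hf hc
  rw [LinearMap.smul_apply, DiffForm.val_smul, ← sum_curryLeft_wedge h1 h2]
  refine Finset.sum_congr rfl fun j _ => ?_
  rw [commutator_comp, show commutator Δ (f c j) = 0 from hΔ _, LinearMap.comp_zero, add_zero,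
    LinearMap.comp_apply, val_commutator_deRham]

theorem contractOp_wedge_zero [T2Space X] (Δ : P →ₗ[ℝ] DiffForm n X 0) (g : SmoothFun n X)
    (hΔ : HasOrderLT (SmoothFun n X) 2 Δ) :
    contractOp ρ hρ f 0 (commutator (deRham n X 0) g ∘ₗ Δ) = commutator Δ g := by
  refine LinearMap.ext fun s => DiffForm.ext_val fun x => ?_
  rw [contractOp_apply, val_contractSum]
  refine eq_sum_smul_of_finsupport ρ x fun c hc => ?_
  rw [← sum_smul_val_commutator hρ hf hΔ g s hc]
  refine Finset.sum_congr rfl fun j _ => ?_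
  rw [commutator_comp_of_order_one (hasOrderLT_deRham 0 g), LinearMap.comp_apply,
    val_commutator_deRham, curryLeft_wedge_zero]

theorem contractOp_wedge [T2Space X] (i : ℕ) (Δ : P →ₗ[ℝ] DiffForm n X (i + 1))
    (g : SmoothFun n X) (hΔ : HasOrderLT (SmoothFun n X) 2 Δ) :
    contractOp ρ hρ f (i + 1) (commutator (deRham n X (i + 1)) g ∘ₗ Δ) +
      commutator (deRham n X i) g ∘ₗ contractOp ρ hρ f i Δ = commutator Δ g := by
  refine LinearMap.ext fun s => DiffForm.ext_val fun x => ?_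
  rw [LinearMap.add_apply, DiffForm.val_add, LinearMap.comp_apply, contractOp_apply,
    contractOp_apply, val_commutator_deRham, val_contractSum, val_contractSum, wedge_sum,
    ← Finset.sum_add_distrib]
  simp only [wedge_smul, ← smul_add]
  refine eq_sum_smul_of_finsupport ρ x fun c hc => ?_
  rw [← sum_smul_val_commutator hρ hf hΔ g s hc, wedge_sum, ← Finset.sum_add_distrib]
  refine Finset.sum_congr rfl fun j _ => ?_
  rw [commutator_comp_of_order_one (hasOrderLT_deRham _ g), LinearMap.comp_apply,
    val_commutator_deRham, curryLeft_wedge]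

omit hρ hf in
/-- On a manifold there is a homotopy operator, given by `∑_c ρ_c ∑_j ι_{∂_j^c} ∘ [·, f_{c,j}]`,
where `f_{c,j}` is a smooth function that agrees with the `j`-th coordinate of the chart at `c` near
the support of `ρ_c`. -/
theorem nonempty_eulerHomotopy [T2Space X] [SigmaCompactSpace X] :
    Nonempty (EulerHomotopy (SmoothFun n X) P n (deRham n X)) := by
  obtain ⟨ρ, hρ⟩ := SmoothPartitionOfUnity.exists_isSubordinate_chartAt_source (𝓡 n) X
  have hex : ∀ (c : X) (j : Fin n), ∃ f : SmoothFun n X,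
      ∀ x ∈ tsupport (ρ c), f =ᶠ[𝓝 x] fun z => extChartAt (𝓡 n) c z j := by
    intro c j
    obtain ⟨χ, h1, hχ⟩ := exists_cutoff_of_isClosed (n := n) (isClosed_tsupport (ρ c))
      (chartAt (Model n) c).open_source (hρ c)
    obtain ⟨f, hf⟩ := exists_smoothFun_cutoff_mul (g := fun z => extChartAt (𝓡 n) c z j)
      (chartAt (Model n) c).open_source hχ (by
        have h2 : ContDiff ℝ ∞ fun y : Model n => y j := by fun_prop
        exact h2.contMDiff.comp_contMDiffOn contMDiffOn_extChartAt)
    refine ⟨f, fun x hx => ?_⟩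
    filter_upwards [h1 x hx] with z hz
    rw [hf, hz, one_mul]
  choose f hf using hex
  exact ⟨{
    h := contractOp ρ hρ f
    h_smul := contractOp_funSmul ρ hρ f
    commutator_h := commutator_contractOp ρ hρ f
    h_of_order_one := contractOp_of_order_one ρ hρ f
    h_d := contractOp_deRham hρ hf
    h_wedge_zero := contractOp_wedge_zero hρ hf
    h_wedge := contractOp_wedge hρ hf }⟩

end Homotopy

/-! ### Operators of order zero are sections of the conjugate bundle -/

section Conj

variable {n : ℕ} {X : Type*} [TopologicalSpace X] [ChartedSpace (Model n) X]
  {F : Type*} [NormedAddCommGroup F] [NormedSpace ℝ F]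
  {V : X → Type*} [TopologicalSpace (Bundle.TotalSpace F V)] [∀ x, AddCommGroup (V x)]
  [∀ x, Module ℝ (V x)] [∀ x, TopologicalSpace (V x)] [FiberBundle F V] [VectorBundle ℝ F V]

theorem Sections.smul_apply (f : SmoothFun n X) (s : Sections n F V) (x : X) :
    (f • s) x = f x • s x := rfl

/-- The value of a section at a point, as a linear map. -/
noncomputable def Sections.valₗ (x : X) : Sections n F V →ₗ[ℝ] V x where
  toFun s := s x
  map_add' _ _ := rfl
  map_smul' _ _ := rfl

theorem Sections.sum_apply {ι : Type*} (S : Finset ι) (σ : ι → Sections n F V) (x : X) :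
    (∑ i ∈ S, σ i) x = ∑ i ∈ S, σ i x := map_sum (Sections.valₗ x) σ S

variable [IsManifold (𝓡 n) ∞ X]

/-- Near every point, sections are linear combinations of finitely many global ones: a local frame
and the coefficients of a section in it are made global by means of a cutoff function `χ`. -/
theorem exists_frame [T2Space X] [FiniteDimensional ℝ F] [ContMDiffVectorBundle ∞ F V (𝓡 n)]
    (x : X) : ∃ (ι : Type) (_ : Fintype ι) (χ : SmoothFun n X) (σ : ι → Sections n F V), χ x = 1 ∧
      (∀ v : V x, ∃ r : ι → ℝ, v = ∑ i, r i • σ i x) ∧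
      ∀ s : Sections n F V, ∃ c : ι → SmoothFun n X,
        χ • χ • s = ∑ i, c i • σ i ∧ (s x = 0 → ∀ i, c i x = 0) := by
  have : ContMDiffVectorBundle 1 F V (𝓡 n) := ContMDiffVectorBundle.of_le (n := ∞) (by simp)
  set e := trivializationAt F V x
  set b := Module.finBasis ℝ F
  have hx : x ∈ e.baseSet := FiberBundle.mem_baseSet_trivializationAt' x
  obtain ⟨χ, h1, hχ⟩ := exists_cutoff (n := n) (e.open_baseSet.mem_nhds hx)
  set σ : Fin (Module.finrank ℝ F) → Sections n F V := fun i =>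
    ⟨(χ : X → ℝ) • e.localFrame b i, ContMDiffOn.smul_section_of_tsupport χ.contMDiff.contMDiffOn
      e.open_baseSet hχ (e.contMDiffOn_localFrame_baseSet ∞ b i)⟩ with hσ
  have hσa : ∀ i z, σ i z = χ z • e.localFrame b i z := fun _ _ => rfl
  refine ⟨_, inferInstance, χ, σ, h1.self_of_nhds, fun v => ?_, fun s => ?_⟩
  · refine ⟨(e.basisAt b hx).repr v, ?_⟩
    conv_lhs => rw [← (e.basisAt b hx).sum_repr v]
    refine Finset.sum_congr rfl fun i _ => ?_
    rw [hσa, h1.self_of_nhds, one_smul, e.localFrame_apply_of_mem_baseSet b hx]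
  · have hc : ∀ i, ∃ f : SmoothFun n X, ∀ z, f z = χ z * e.localFrameCoeff (𝓡 n) b i z (s z) :=
      fun i => exists_smoothFun_cutoff_mul e.open_baseSet hχ
        (contMDiffOn_baseSet_localFrameCoeff (e := e) b s.contMDiff.contMDiffOn i)
    choose c hc using hc
    refine ⟨c, ContMDiffSection.ext fun z => ?_, fun h0 i => ?_⟩
    · rw [Sections.sum_apply, Sections.smul_apply, Sections.smul_apply]
      simp only [Sections.smul_apply, hσa, hc]
      by_cases hz : z ∈ e.baseSet
      · conv_lhs => rw [e.eq_sum_localFrameCoeff_smul (I := 𝓡 n) (b := b) (s := fun z => s z) hz]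
        simp only [Finset.smul_sum, smul_smul]
        exact Finset.sum_congr rfl fun i _ => by congr 1; ring
      · rw [image_eq_zero_of_notMem_tsupport fun h => hz (hχ h)]
        simp
    · rw [hc, h0, map_zero, mul_zero]

/-- An operator of order zero is given by a map of fibres: the value of `L s` at a point depends
only on the value of `s` there. -/
theorem val_eq_zero_of_apply_eq_zero [T2Space X] [FiniteDimensional ℝ F]
    [ContMDiffVectorBundle ∞ F V (𝓡 n)] {k : ℕ} {L : Sections n F V →ₗ[ℝ] DiffForm n X k}
    (hL : HasOrderLT (SmoothFun n X) 1 L) {s : Sections n F V} {x : X} (hs : s x = 0) :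
    (L s).val x = 0 := by
  obtain ⟨ι, _, χ, σ, h1, -, hc⟩ := exists_frame (n := n) (F := F) (V := V) x
  obtain ⟨c, hcs, hc0⟩ := hc s
  have h2 : (L (χ • χ • s)).val x = (L s).val x := by
    rw [hL.map_smul, hL.map_smul, DiffForm.val_funSmul, DiffForm.val_funSmul, h1, one_smul,
      one_smul]
  rw [← h2, hcs, map_sum]
  change DiffForm.valₗ x _ = 0
  rw [map_sum]
  refine Finset.sum_eq_zero fun i _ => ?_
  change (L (c i • σ i)).val x = 0
  rw [hL.map_smul, DiffForm.val_funSmul, hc0 hs, zero_smul]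

theorem exists_section_through [T2Space X] [FiniteDimensional ℝ F]
    [ContMDiffVectorBundle ∞ F V (𝓡 n)] {x : X} (v : V x) : ∃ s : Sections n F V, s x = v := by
  obtain ⟨ι, _, χ, σ, -, h, -⟩ := exists_frame (n := n) (F := F) (V := V) x
  obtain ⟨r, hr⟩ := h v
  exact ⟨∑ i, r i • σ i, by rw [Sections.sum_apply, hr]; rfl⟩

variable (n F V) in
/-- The pairing as a bilinear map. -/
noncomputable def pairingₗ : ConjSections n F V →ₗ[ℝ] Sections n F V →ₗ[ℝ] DiffForm n X n where
  toFun B :=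
    { toFun := fun s => pairing B s
      map_add' := fun s t => Subtype.ext <| funext fun x => LinearMap.map_add (B.1 x) (s x) (t x)
      map_smul' := fun c s => Subtype.ext <| funext fun x => LinearMap.map_smul (B.1 x) c (s x) }
  map_add' _ _ := rfl
  map_smul' _ _ := rfl

theorem hasOrderLT_pairing (B : ConjSections n F V) :
    HasOrderLT (SmoothFun n X) 1 (pairingₗ n F V B) :=
  hasOrderLT_one_iff.2 fun f s => Subtype.ext <| funext fun x =>
    LinearMap.map_smul (B.1 x) (f x) (s x)

theorem hasOrderLT_pairing_flip (s : Sections n F V) :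
    HasOrderLT (SmoothFun n X) 1 ((pairingₗ n F V).flip s) :=
  hasOrderLT_one_iff.2 fun _ _ => rfl

section

variable [T2Space X] [FiniteDimensional ℝ F] [ContMDiffVectorBundle ∞ F V (𝓡 n)]

theorem ConjSections.ext_pairing {B C : ConjSections n F V} (h : ∀ s, pairing B s = pairing C s) :
    B = C := by
  refine Subtype.ext <| funext fun x => LinearMap.ext fun v => ?_
  obtain ⟨s, rfl⟩ := exists_section_through (n := n) (F := F) v
  exact congrFun (congrArg Subtype.val (h s)) x

/-- Operators of order zero with values in `n`-forms are the pairings with sections of `α̂`. -/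
theorem exists_conjSection {L : Sections n F V →ₗ[ℝ] DiffForm n X n}
    (hL : HasOrderLT (SmoothFun n X) 1 L) : ∃ B : ConjSections n F V, ∀ s, pairing B s = L s := by
  choose σ hσ using fun (x : X) (v : V x) => exists_section_through (n := n) (F := F) v
  have h0 : ∀ x (s t : Sections n F V), s x = t x → (L s).val x = (L t).val x := fun x s t h => by
    have h1 := val_eq_zero_of_apply_eq_zero hL (s := s - t) (x := x)
      ((map_sub (Sections.valₗ x) s t).trans (sub_eq_zero.2 h))
    rwa [map_sub, DiffForm.val_sub, sub_eq_zero] at h1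
  let B : ∀ x : X, ConjFibre n V x := fun x =>
    show V x →ₗ[ℝ] FormAt n n x from
    { toFun := fun v => (L (σ x v)).1 x
      map_add' := fun v w => by
        have h := h0 x (σ x (v + w)) (σ x v + σ x w)
          ((hσ x _).trans (congrArg₂ (· + ·) (hσ x v) (hσ x w)).symm)
        rw [map_add] at h
        exact h
      map_smul' := fun c v => by
        have h := h0 x (σ x (c • v)) (c • σ x v)
          ((hσ x _).trans (congrArg (c • ·) (hσ x v)).symm)
        rw [map_smul] at h
        exact h }
  have hB : ∀ s : Sections n F V, (fun x => (B x).eval (s x)) = (L s).1 := fun s =>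
    funext fun x => h0 x _ _ (hσ x _)
  exact ⟨⟨B, fun s => by rw [hB]; exact (L s).2⟩, fun s => Subtype.ext (hB s)⟩

end

end Conj

/-! ### Exactness of multilinear operators -/

section ExactLin

variable (n : ℕ) {X : Type*} [TopologicalSpace X] [ChartedSpace (Model n) X]
  (F : Type*) [NormedAddCommGroup F] [NormedSpace ℝ F]
  (V : X → Type*) [TopologicalSpace (Bundle.TotalSpace F V)] [∀ x, AddCommGroup (V x)]
  [∀ x, Module ℝ (V x)] [∀ x, TopologicalSpace (V x)] [FiberBundle F V] [VectorBundle ℝ F V]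
  [IsManifold (𝓡 n) ∞ X]

/-- The linear operators of the form `d ∘ G`, with `G` a linear differential operator. -/
noncomputable def exactLin : ∀ i : ℕ, Submodule ℝ (Sections n F V →ₗ[ℝ] DiffForm n X i)
  | 0 => ⊥
  | i + 1 => {
      carrier := {L | ∃ (k : ℕ) (G : Sections n F V →ₗ[ℝ] DiffForm n X i),
        HasOrderLT (SmoothFun n X) k G ∧ L = deRham n X i ∘ₗ G}
      zero_mem' := ⟨0, 0, HasOrderLT.zero _, (LinearMap.comp_zero _).symm⟩
      add_mem' := by
        rintro _ _ ⟨k, G, hG, rfl⟩ ⟨k', G', hG', rfl⟩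
        exact ⟨max k k', G + G', (hG.mono (le_max_left _ _)).add (hG'.mono (le_max_right _ _)),
          (LinearMap.comp_add _ _ _).symm⟩
      smul_mem' := by
        rintro c _ ⟨k, G, hG, rfl⟩
        exact ⟨k, c • G, hG.smul c, (LinearMap.comp_smul _ _ _).symm⟩ }

variable {n F V}

theorem exactLin_comp {i : ℕ} {L : Sections n F V →ₗ[ℝ] DiffForm n X i} (hL : L ∈ exactLin n F V i)
    {a : ℕ} {D : Sections n F V →ₗ[ℝ] Sections n F V} (hD : HasOrderLT (SmoothFun n X) a D) :
    L ∘ₗ D ∈ exactLin n F V i := by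
  cases i with
  | zero => rw [show L = 0 from hL, LinearMap.zero_comp]; exact zero_mem _
  | succ i =>
    obtain ⟨k, G, hG, rfl⟩ := hL
    exact ⟨k + a, G ∘ₗ D, hG.comp hD, LinearMap.comp_assoc _ _ _⟩

theorem toLinearMap_mem_exactLin {l i : ℕ}
    {E : MultilinearMap ℝ (fun _ : Fin l => Sections n F V) (DiffForm n X i)}
    (hE : E ∈ exactOp n F V l i) (s : Fin l → Sections n F V) (j : Fin l) :
    E.toLinearMap s j ∈ exactLin n F V i := by
  cases i with
  | zero => rw [show E = 0 from hE, toLinearMap_zero]; exact zero_mem _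
  | succ i =>
    obtain ⟨G, ⟨k, hk⟩, rfl⟩ := hE
    exact ⟨k, G.toLinearMap s j, hk s j, rfl⟩

theorem curryRight_eq_toLinearMap {P Q : Type*} [AddCommGroup P] [Module ℝ P] [AddCommGroup Q]
    [Module ℝ Q] {m : ℕ} (Δ : MultilinearMap ℝ (fun _ : Fin (m + 1) => P) Q) (s : Fin m → P) :
    Δ.curryRight s = Δ.toLinearMap (Fin.snoc s 0) (Fin.last m) := by
  ext p
  rw [MultilinearMap.curryRight_apply, MultilinearMap.toLinearMap_apply, Fin.update_snoc_last]

theorem curryRight_mem_exactLin {m i : ℕ}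
    {E : MultilinearMap ℝ (fun _ : Fin (m + 1) => Sections n F V) (DiffForm n X i)}
    (hE : E ∈ exactOp n F V (m + 1) i) (s : Fin m → Sections n F V) :
    E.curryRight s ∈ exactLin n F V i := by
  rw [curryRight_eq_toLinearMap]
  exact toLinearMap_mem_exactLin hE _ _

omit [IsManifold (𝓡 n) ∞ X] in
theorem eq_zero_of_degree_gt {k : ℕ} (hk : n < k) (η : DiffForm n X k) : η = 0 := by
  refine DiffForm.ext_val fun x => ContinuousAlternatingMap.ext fun v => ?_
  refine (η.val x).toAlternatingMap.map_linearDependent v fun h => ?_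
  have := h.fintype_card_le_finrank
  simp at this
  omega

variable [T2Space X] [SigmaCompactSpace X]

/-- A differential operator with values in `n`-forms that is exact and of order zero vanishes. -/
theorem eq_zero_of_mem_exactLin {L : Sections n F V →ₗ[ℝ] DiffForm n X n}
    (hL : L ∈ exactLin n F V n) (h1 : HasOrderLT (SmoothFun n X) 1 L) : L = 0 := by
  obtain ⟨H⟩ := nonempty_eulerHomotopy (n := n) (X := X) (P := Sections n F V)
  have key : ∀ i, i = n → ∀ L : Sections n F V →ₗ[ℝ] DiffForm n X i, L ∈ exactLin n F V i →
      HasOrderLT (SmoothFun n X) 1 L → L = 0 := by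
    rintro (_ | i) hi L hL h1
    · exact hL
    · obtain ⟨k, G, hG, rfl⟩ := hL
      exact H.d_comp_eq_zero hasOrderLT_deRham (fun i η => deRham_deRham η) hi hG h1
  exact key n rfl L hL h1

/-- A closed multilinear operator is, up to an exact one, of order zero in its last argument, and
exact in degree `< n`: a primitive is obtained by acting on the last argument. -/
theorem exists_exactOp_hasOrderLT_sub {m i : ℕ} (hi : i ≤ n)
    {Δ : MultilinearMap ℝ (fun _ : Fin (m + 1) => Sections n F V) (DiffForm n X i)}
    (hΔ : Δ ∈ multiDiffOp (SmoothFun n X) (Sections n F V) (DiffForm n X i) (m + 1))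
    (hcl : ∀ s, deRham n X i (Δ s) = 0) :
    ∃ E ∈ exactOp n F V (m + 1) i,
      (∀ s, HasOrderLT (SmoothFun n X) 1 ((Δ - E).curryRight s)) ∧ (i < n → Δ = E) := by
  obtain ⟨H⟩ := nonempty_eulerHomotopy (n := n) (X := X) (P := Sections n F V)
  obtain ⟨k, hk⟩ := (mem_multiDiffOp_succ_iff.1 hΔ).2
  have hcl' : ∀ s, deRham n X i ∘ₗ Δ.curryRight s = 0 := fun s =>
    LinearMap.ext fun t => hcl _
  have hext : ∀ {E : MultilinearMap ℝ (fun _ : Fin (m + 1) => Sections n F V) (DiffForm n X i)},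
      (∀ s, Δ.curryRight s = E.curryRight s) → Δ = E := fun {E} h => by
    rw [← MultilinearMap.uncurry_curryRight Δ, ← MultilinearMap.uncurry_curryRight E,
      MultilinearMap.ext h]
  rcases i with _ | i
  · refine ⟨0, zero_mem _, fun s => ?_, fun h0 => hext fun s => ?_⟩
    · rw [sub_zero]
      exact (H.hasOrderLT_of_closed_zero hasOrderLT_deRham (hk s) (hcl' s)).1
    · exact (H.hasOrderLT_of_closed_zero hasOrderLT_deRham (hk s) (hcl' s)).2 h0
  · have h := fun s => H.hasOrderLT_sub_primitive hasOrderLT_deRham (fun i η => deRham_deRham η) hi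
      (hk s) (hcl' s)
    refine ⟨(deRham n X i).compMultilinearMap (mapLast (H.primitive i k) Δ),
      ⟨_, (H.isRegular_primitive hasOrderLT_deRham i k).mapLast_mem hΔ, rfl⟩, fun s => ?_,
      fun h0 => hext fun s => ?_⟩
    · have h2 := (h s).1
      rw [← curryRight_mapLast] at h2
      exact h2
    · have h2 := (h s).2 h0
      rw [← curryRight_mapLast, sub_eq_zero] at h2
      exact h2

/-- In degree `n`, exactness can be tested with respect to the last argument only, the others being
fixed. -/
theorem mem_exactOp_of_curryRight {m : ℕ}
    {Δ : MultilinearMap ℝ (fun _ : Fin (m + 1) => Sections n F V) (DiffForm n X n)}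
    (hΔ : Δ ∈ multiDiffOp (SmoothFun n X) (Sections n F V) (DiffForm n X n) (m + 1))
    (h : ∀ s, Δ.curryRight s ∈ exactLin n F V n) : Δ ∈ exactOp n F V (m + 1) n := by
  obtain ⟨E, hE, h1, -⟩ := exists_exactOp_hasOrderLT_sub le_rfl hΔ
    fun s => eq_zero_of_degree_gt (Nat.lt_succ_self n) _
  have h2 : Δ = E := by
    rw [← sub_eq_zero, ← MultilinearMap.uncurry_curryRight (Δ - E)]
    have h3 : (Δ - E).curryRight = 0 := MultilinearMap.ext fun s =>
      eq_zero_of_mem_exactLin (sub_mem (h s) (curryRight_mem_exactLin hE s)) (h1 s)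
    rw [h3]
    rfl
  rw [h2]
  exact hE

end ExactLin

/-! ### Changes of arguments and symmetrization -/

section Arguments

variable {A : Type*} [CommRing A] [Algebra ℝ A]
  {P : Type*} [AddCommGroup P] [Module ℝ P] [Module A P] [IsScalarTower ℝ A P]
  {Q : Type*} [AddCommGroup Q] [Module ℝ Q] [Module A Q] [IsScalarTower ℝ A Q]
  {l k : ℕ}

theorem extend_update {ι κ β : Type*} [DecidableEq ι] [DecidableEq κ] (e : κ ↪ ι) (a : κ → β)
    (w : ι → β) (i : κ) (p : β) :
    Function.extend e (Function.update a i p) w =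
      Function.update (Function.extend e a w) (e i) p := by
  funext j
  by_cases hj : ∃ i', e i' = j
  · obtain ⟨i', rfl⟩ := hj
    rw [e.injective.extend_apply]
    rcases eq_or_ne i' i with rfl | hi
    · rw [Function.update_self, Function.update_self]
    · rw [Function.update_of_ne hi, Function.update_of_ne (e.injective.ne hi),
        e.injective.extend_apply]
  · have hj' : j ≠ e i := fun h => hj ⟨i, h.symm⟩
    rw [Function.extend_apply' _ _ _ hj, Function.update_of_ne hj',
      Function.extend_apply' _ _ _ hj]

/-- The multilinear map obtained by fixing all arguments but those numbered by `e`. -/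
noncomputable def restrictArgs (e : Fin k ↪ Fin l) (w : Fin l → P)
    (Δ : MultilinearMap ℝ (fun _ : Fin l => P) Q) : MultilinearMap ℝ (fun _ : Fin k => P) Q where
  toFun a := Δ (Function.extend e a w)
  map_update_add' a i p q := by
    simp only [extend_update, MultilinearMap.map_update_add]
  map_update_smul' a i c p := by
    simp only [extend_update, MultilinearMap.map_update_smul]

theorem restrictArgs_apply (e : Fin k ↪ Fin l) (w : Fin l → P)
    (Δ : MultilinearMap ℝ (fun _ : Fin l => P) Q) (a : Fin k → P) :
    restrictArgs e w Δ a = Δ (Function.extend e a w) := rfl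

theorem restrictArgs_mem (e : Fin k ↪ Fin l) (w : Fin l → P)
    {Δ : MultilinearMap ℝ (fun _ : Fin l => P) Q} (hΔ : Δ ∈ multiDiffOp A P Q l) :
    restrictArgs e w Δ ∈ multiDiffOp A P Q k := by
  obtain ⟨c, hc⟩ := hΔ
  refine ⟨c, fun a i => ?_⟩
  have h : (restrictArgs e w Δ).toLinearMap a i =
      Δ.toLinearMap (Function.extend e a w) (e i) := by
    ext p
    simp only [MultilinearMap.toLinearMap_apply, restrictArgs_apply, extend_update]
  rw [h]
  exact hc _ _

theorem domDomCongr_mem (σ : Equiv.Perm (Fin l)) {Δ : MultilinearMap ℝ (fun _ : Fin l => P) Q}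
    (hΔ : Δ ∈ multiDiffOp A P Q l) : Δ.domDomCongr σ ∈ multiDiffOp A P Q l := by
  obtain ⟨c, hc⟩ := hΔ
  refine ⟨c, fun s i => ?_⟩
  have h : (Δ.domDomCongr σ).toLinearMap s i = Δ.toLinearMap (s ∘ σ) (σ.symm i) := by
    ext p
    simp only [MultilinearMap.toLinearMap_apply, MultilinearMap.domDomCongr_apply]
    exact congrArg Δ (Function.update_comp_equiv s σ i p)
  rw [h]
  exact hc _ _

variable (P Q l) in
/-- The average of a multilinear map over the permutations of its arguments. -/
noncomputable def symmetrize : MultilinearMap ℝ (fun _ : Fin l => P) Q →ₗ[ℝ]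
    MultilinearMap ℝ (fun _ : Fin l => P) Q :=
  (Fintype.card (Equiv.Perm (Fin l)) : ℝ)⁻¹ • ∑ σ : Equiv.Perm (Fin l),
    (MultilinearMap.domDomCongrLinearEquiv ℝ ℝ P Q σ).toLinearMap

theorem symmetrize_eq (Δ : MultilinearMap ℝ (fun _ : Fin l => P) Q) :
    symmetrize P Q l Δ = (Fintype.card (Equiv.Perm (Fin l)) : ℝ)⁻¹ •
      ∑ σ : Equiv.Perm (Fin l), Δ.domDomCongr σ := by
  rw [symmetrize, LinearMap.smul_apply, LinearMap.sum_apply]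
  rfl

theorem symmetrize_mem {S : Submodule ℝ (MultilinearMap ℝ (fun _ : Fin l => P) Q)}
    {Δ : MultilinearMap ℝ (fun _ : Fin l => P) Q}
    (h : ∀ σ : Equiv.Perm (Fin l), Δ.domDomCongr σ ∈ S) : symmetrize P Q l Δ ∈ S := by
  rw [symmetrize_eq]
  exact S.smul_mem _ (sum_mem fun σ _ => h σ)

theorem symmetrize_sub_mem {S : Submodule ℝ (MultilinearMap ℝ (fun _ : Fin l => P) Q)}
    {Δ : MultilinearMap ℝ (fun _ : Fin l => P) Q}
    (h : ∀ σ : Equiv.Perm (Fin l), Δ.domDomCongr σ - Δ ∈ S) : symmetrize P Q l Δ - Δ ∈ S := by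
  have hc : (Fintype.card (Equiv.Perm (Fin l)) : ℝ) ≠ 0 := Nat.cast_ne_zero.2 Fintype.card_ne_zero
  have h1 : symmetrize P Q l Δ - Δ = (Fintype.card (Equiv.Perm (Fin l)) : ℝ)⁻¹ •
      ∑ σ : Equiv.Perm (Fin l), (Δ.domDomCongr σ - Δ) := by
    rw [symmetrize_eq, Finset.sum_sub_distrib, smul_sub, Finset.sum_const, Finset.card_univ,
      ← Nat.cast_smul_eq_nsmul ℝ, smul_smul, inv_mul_cancel₀ hc, one_smul]
  rw [h1]
  exact S.smul_mem _ (sum_mem fun σ _ => h σ)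

theorem symmetrize_eq_self {Δ : MultilinearMap ℝ (fun _ : Fin l => P) Q}
    (h : ∀ σ : Equiv.Perm (Fin l), Δ.domDomCongr σ = Δ) : symmetrize P Q l Δ = Δ := by
  have h1 := symmetrize_sub_mem (S := ⊥) (Δ := Δ) fun σ => by rw [h, sub_self]; exact zero_mem _
  exact sub_eq_zero.1 h1

theorem symmetrize_mem_symDiffOp {Δ : MultilinearMap ℝ (fun _ : Fin l => P) Q}
    (hΔ : Δ ∈ multiDiffOp A P Q l) : symmetrize P Q l Δ ∈ symDiffOp A P Q l := by
  refine ⟨symmetrize_mem fun σ => domDomCongr_mem σ hΔ, fun τ s => ?_⟩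
  rw [symmetrize_eq, smul_apply, smul_apply, sum_apply,
    sum_apply]
  congr 1
  exact Fintype.sum_equiv (Equiv.mulLeft τ) _ _ fun σ => rfl

theorem symmetrize_compMultilinearMap {R : Type*} [AddCommGroup R] [Module ℝ R] (D : Q →ₗ[ℝ] R)
    (Δ : MultilinearMap ℝ (fun _ : Fin l => P) Q) :
    symmetrize P R l (D.compMultilinearMap Δ) = D.compMultilinearMap (symmetrize P Q l Δ) := by
  refine MultilinearMap.ext fun s => ?_
  simp only [symmetrize_eq, smul_apply, sum_apply,
    LinearMap.compMultilinearMap_apply, map_smul, map_sum]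
  rfl

theorem domDomCongr_of_mem_symDiffOp {Δ : MultilinearMap ℝ (fun _ : Fin l => P) Q}
    (hΔ : Δ ∈ symDiffOp A P Q l) (σ : Equiv.Perm (Fin l)) : Δ.domDomCongr σ = Δ :=
  MultilinearMap.ext fun s => hΔ.2 σ s

/-- A permutation of the arguments but the last, as a permutation of all arguments. -/
def extendLast {m : ℕ} (τ : Equiv.Perm (Fin m)) : Equiv.Perm (Fin (m + 1)) :=
  finSuccEquivLast.symm.permCongr (Equiv.optionCongr τ)

theorem extendLast_castSucc {m : ℕ} (τ : Equiv.Perm (Fin m)) (j : Fin m) :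
    extendLast τ j.castSucc = (τ j).castSucc := by
  simp [extendLast, Equiv.permCongr_apply]

theorem extendLast_last {m : ℕ} (τ : Equiv.Perm (Fin m)) :
    extendLast τ (Fin.last m) = Fin.last m := by
  simp [extendLast, Equiv.permCongr_apply]

omit [AddCommGroup P] [Module ℝ P] in
theorem snoc_comp_extendLast {m : ℕ} (τ : Equiv.Perm (Fin m)) (s : Fin m → P) (t : P) :
    (Fin.snoc s t : Fin (m + 1) → P) ∘ extendLast τ = Fin.snoc (s ∘ τ) t := by
  funext j
  refine Fin.lastCases ?_ (fun j => ?_) j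
  · rw [Function.comp_apply, extendLast_last, Fin.snoc_last, Fin.snoc_last]
  · rw [Function.comp_apply, extendLast_castSucc, Fin.snoc_castSucc, Fin.snoc_castSucc]; rfl

theorem exists_eq_swap_mul_extendLast {m : ℕ} (σ : Equiv.Perm (Fin (m + 1))) :
    ∃ (j : Fin (m + 1)) (τ : Equiv.Perm (Fin m)),
      σ = Equiv.swap j (Fin.last m) * extendLast τ := by
  obtain ⟨⟨o, τ⟩, h⟩ := Equiv.Perm.decomposeOption.symm.surjective (finSuccEquivLast.permCongr σ)
  refine ⟨finSuccEquivLast.symm o, τ, ?_⟩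
  rw [Equiv.Perm.decomposeOption_symm_apply] at h
  have h2 := congrArg finSuccEquivLast.symm.permCongr h
  rw [← Equiv.permCongr_symm, Equiv.symm_apply_apply] at h2
  rw [← h2]
  ext1 j
  simp only [extendLast, Equiv.permCongr_symm, Equiv.permCongr_apply, Equiv.Perm.mul_apply,
    Equiv.symm_symm]
  rw [finSuccEquivLast.symm.injective.map_swap, Equiv.swap_comm, finSuccEquivLast_symm_none]

omit [AddCommGroup P] [Module ℝ P] in
theorem snoc_comp_swap {m : ℕ} (s : Fin m → P) (t : P) (j : Fin m) :
    (Fin.snoc s t : Fin (m + 1) → P) ∘ Equiv.swap j.castSucc (Fin.last m) =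
      Fin.snoc (Function.update s j t) (s j) := by
  funext i
  refine Fin.lastCases ?_ (fun i => ?_) i
  · rw [Function.comp_apply, Equiv.swap_apply_right, Fin.snoc_last, Fin.snoc_castSucc]
  · rw [Function.comp_apply, Fin.snoc_castSucc]
    rcases eq_or_ne i j with rfl | h
    · rw [Equiv.swap_apply_left, Fin.snoc_last, Function.update_self]
    · rw [Equiv.swap_apply_of_ne_of_ne ((Fin.castSucc_injective m).ne h) (Fin.castSucc_lt_last i).ne,
        Fin.snoc_castSucc, Function.update_of_ne h]

end Arguments

/-! ### Operators with values in the conjugate bundle -/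

section PairLast

variable {n : ℕ} {X : Type*} [TopologicalSpace X] [ChartedSpace (Model n) X]
  {F : Type*} [NormedAddCommGroup F] [NormedSpace ℝ F]
  {V : X → Type*} [TopologicalSpace (Bundle.TotalSpace F V)] [∀ x, AddCommGroup (V x)]
  [∀ x, Module ℝ (V x)] [∀ x, TopologicalSpace (V x)] [FiberBundle F V] [VectorBundle ℝ F V]
  {l k m i : ℕ}

variable (n F V m) in
/-- The map sending `D` to the operator `⟨D(s₁, …, s_m), s_{m+1}⟩`. -/
noncomputable def pairLast : MultilinearMap ℝ (fun _ : Fin m => Sections n F V) (ConjSections n F V)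
    →ₗ[ℝ] MultilinearMap ℝ (fun _ : Fin (m + 1) => Sections n F V) (DiffForm n X n) where
  toFun D := ((pairingₗ n F V).compMultilinearMap D).uncurryRight
  map_add' _ _ := rfl
  map_smul' _ _ := rfl

theorem curryRight_pairLast
    (D : MultilinearMap ℝ (fun _ : Fin m => Sections n F V) (ConjSections n F V)) :
    (pairLast n F V m D).curryRight = (pairingₗ n F V).compMultilinearMap D :=
  MultilinearMap.curry_uncurryRight _

theorem pairLast_snoc
    (D : MultilinearMap ℝ (fun _ : Fin m => Sections n F V) (ConjSections n F V))
    (s : Fin m → Sections n F V) (t : Sections n F V) :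
    pairLast n F V m D (Fin.snoc s t) = pairing (D s) t := by
  rw [← MultilinearMap.curryRight_apply, curryRight_pairLast]
  rfl

variable [IsManifold (𝓡 n) ∞ X]

theorem pairLast_mem {D : MultilinearMap ℝ (fun _ : Fin m => Sections n F V) (ConjSections n F V)}
    (hD : D ∈ multiDiffOp (SmoothFun n X) (Sections n F V) (ConjSections n F V) m) :
    pairLast n F V m D ∈
      multiDiffOp (SmoothFun n X) (Sections n F V) (DiffForm n X n) (m + 1) := by
  rw [mem_multiDiffOp_succ_iff, curryRight_pairLast]
  obtain ⟨k, hk⟩ := hD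
  have h1 : HasOrderLT (SmoothFun n X) 1 (pairingₗ n F V) := hasOrderLT_one_iff.2 fun _ _ => rfl
  exact ⟨⟨1 + k, fun s j => h1.comp (hk s j)⟩, 1, fun s => hasOrderLT_pairing (D s)⟩

theorem exactOp_le_multiDiffOp : exactOp n F V l i ≤
    multiDiffOp (SmoothFun n X) (Sections n F V) (DiffForm n X i) l := by
  intro E hE
  cases i with
  | zero => rw [show E = 0 from hE]; exact zero_mem _
  | succ i =>
    obtain ⟨G, hG, rfl⟩ := hE
    exact comp_mem_multiDiffOp (hasOrderLT_deRham i) hG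

theorem domDomCongr_mem_exactOp
    {E : MultilinearMap ℝ (fun _ : Fin l => Sections n F V) (DiffForm n X i)}
    (hE : E ∈ exactOp n F V l i) (σ : Equiv.Perm (Fin l)) : E.domDomCongr σ ∈ exactOp n F V l i := by
  cases i with
  | zero => rw [show E = 0 from hE]; exact zero_mem _
  | succ i =>
    obtain ⟨G, hG, rfl⟩ := hE
    exact ⟨G.domDomCongr σ, domDomCongr_mem σ hG, rfl⟩

theorem restrictArgs_mem_exactOp
    {E : MultilinearMap ℝ (fun _ : Fin l => Sections n F V) (DiffForm n X i)}
    (hE : E ∈ exactOp n F V l i) (e : Fin k ↪ Fin l) (w : Fin l → Sections n F V) :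
    restrictArgs e w E ∈ exactOp n F V k i := by
  cases i with
  | zero => rw [show E = 0 from hE]; exact zero_mem _
  | succ i =>
    obtain ⟨G, hG, rfl⟩ := hE
    exact ⟨restrictArgs e w G, restrictArgs_mem e w hG, rfl⟩

/-- A symmetric operator is a coboundary of the complex of symmetric operators as soon as it is
exact: a primitive can be made symmetric by averaging. -/
theorem mem_symCoboundaries_iff {Δ : SymOp n F V l i} :
    Δ ∈ symCoboundaries n F V l i ↔ Δ.1 ∈ exactOp n F V l i := by
  cases i with
  | zero => exact Subtype.ext_iff
  | succ i =>
    constructor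
    · rintro ⟨G, rfl⟩
      exact ⟨G.1, G.2.1, rfl⟩
    · rintro ⟨G, hG, h⟩
      refine ⟨⟨symmetrize _ _ l G, symmetrize_mem_symDiffOp hG⟩, Subtype.ext ?_⟩
      change (deRham n X i).compMultilinearMap (symmetrize _ _ l G) = Δ.1
      rw [← symmetrize_compMultilinearMap, ← h]
      exact symmetrize_eq_self fun σ => domDomCongr_of_mem_symDiffOp Δ.2 σ

variable [T2Space X] [SigmaCompactSpace X] [FiniteDimensional ℝ F]
  [ContMDiffVectorBundle ∞ F V (𝓡 n)]

/-- If `⟨D(s₁, …, s_m), s_{m+1}⟩` is exact, then `D = 0`. -/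
theorem eq_zero_of_pairLast_mem_exactOp
    {D : MultilinearMap ℝ (fun _ : Fin m => Sections n F V) (ConjSections n F V)}
    (hD : pairLast n F V m D ∈ exactOp n F V (m + 1) n) : D = 0 := by
  refine MultilinearMap.ext fun s => ConjSections.ext_pairing fun t => ?_
  have h1 : pairingₗ n F V (D s) = 0 := by
    refine eq_zero_of_mem_exactLin ?_ (hasOrderLT_pairing (D s))
    have h2 := curryRight_mem_exactLin hD s
    rwa [curryRight_pairLast] at h2
  exact LinearMap.congr_fun h1 t

/-- Every operator with values in `n`-forms is, up to an exact one, of the form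
`⟨D(s₁, …, s_m), s_{m+1}⟩`. -/
theorem exists_sub_pairLast_mem_exactOp
    {Δ : MultilinearMap ℝ (fun _ : Fin (m + 1) => Sections n F V) (DiffForm n X n)}
    (hΔ : Δ ∈ multiDiffOp (SmoothFun n X) (Sections n F V) (DiffForm n X n) (m + 1)) :
    ∃ D ∈ multiDiffOp (SmoothFun n X) (Sections n F V) (ConjSections n F V) m,
      Δ - pairLast n F V m D ∈ exactOp n F V (m + 1) n := by
  obtain ⟨E, hE, h1, -⟩ := exists_exactOp_hasOrderLT_sub le_rfl hΔ
    fun s => eq_zero_of_degree_gt (Nat.lt_succ_self n) _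
  have hinj : Function.Injective (pairingₗ n F V) := fun B C h =>
    ConjSections.ext_pairing fun s => LinearMap.congr_fun h s
  have hr : ∀ s, (Δ - E).curryRight s ∈ LinearMap.range (pairingₗ n F V) := fun s => by
    obtain ⟨B, hB⟩ := exists_conjSection (h1 s)
    exact ⟨B, LinearMap.ext hB⟩
  set D := (LinearEquiv.ofInjective _ hinj).symm.toLinearMap.compMultilinearMap
    ((Δ - E).curryRight.codRestrict _ hr) with hDdef
  have hD : (pairingₗ n F V).compMultilinearMap D = (Δ - E).curryRight :=
    MultilinearMap.ext fun s => congrArg Subtype.val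
      ((LinearEquiv.ofInjective _ hinj).apply_symm_apply ⟨(Δ - E).curryRight s, hr s⟩)
  refine ⟨D, ?_, ?_⟩
  · obtain ⟨c, hc⟩ :=
      (mem_multiDiffOp_succ_iff.1 (sub_mem hΔ (exactOp_le_multiDiffOp hE))).1
    refine ⟨1 + c, fun s j => hasOrderLT_of_forall_comp (fun t => hasOrderLT_pairing_flip t)
      (fun B hB => ConjSections.ext_pairing hB) fun t => ?_⟩
    have h2 := (hasOrderLT_one_applyₗ (A := SmoothFun n X) t).comp (hc s j)
    rw [← hD] at h2
    exact h2
  · have h2 : pairLast n F V m D = Δ - E := by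
      rw [← MultilinearMap.uncurry_curryRight (pairLast n F V m D), curryRight_pairLast, hD,
        MultilinearMap.uncurry_curryRight]
    rw [h2, sub_sub_cancel]
    exact hE

/-- If a symmetric operator is, up to an exact one, `⟨D(s₁, …, s_m), s_{m+1}⟩`, then `D` is
symmetric, and formally self-adjoint in each argument. -/
theorem mem_selfAdjointOp_of_sub_mem_exactOp
    {Δ : MultilinearMap ℝ (fun _ : Fin (m + 1) => Sections n F V) (DiffForm n X n)}
    (hΔ : ∀ (σ : Equiv.Perm (Fin (m + 1))) (s : Fin (m + 1) → Sections n F V), Δ (s ∘ σ) = Δ s)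
    {D : MultilinearMap ℝ (fun _ : Fin m => Sections n F V) (ConjSections n F V)}
    (hD : D ∈ multiDiffOp (SmoothFun n X) (Sections n F V) (ConjSections n F V) m)
    (hE : Δ - pairLast n F V m D ∈ exactOp n F V (m + 1) n) : D ∈ selfAdjointOp n F V m := by
  refine ⟨⟨hD, fun τ s => ?_⟩, fun s j => ?_⟩
  · -- `⟨D(s ∘ τ) - D(s), t⟩` is exact, hence zero.
    have h1 : pairLast n F V m (D.domDomCongr τ - D) = (Δ - pairLast n F V m D) -
        (Δ - pairLast n F V m D).domDomCongr (extendLast τ) := by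
      refine MultilinearMap.ext fun v => ?_
      obtain ⟨s, t, rfl⟩ : ∃ s t, v = Fin.snoc s t := ⟨Fin.init v, v (Fin.last m), by simp⟩
      change pairLast n F V m (D.domDomCongr τ - D) (Fin.snoc s t) =
        (Δ (Fin.snoc s t) - pairLast n F V m D (Fin.snoc s t)) -
          (Δ ((Fin.snoc s t : Fin (m + 1) → Sections n F V) ∘ extendLast τ) -
            pairLast n F V m D ((Fin.snoc s t : Fin (m + 1) → Sections n F V) ∘ extendLast τ))
      rw [hΔ, snoc_comp_extendLast, pairLast_snoc, pairLast_snoc, pairLast_snoc]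
      change pairing (D (s ∘ τ)) t - pairing (D s) t = _
      abel
    have h2 := eq_zero_of_pairLast_mem_exactOp (D := D.domDomCongr τ - D) (by
      rw [h1]
      exact sub_mem hE (domDomCongr_mem_exactOp hE _))
    exact congrArg (fun D' => D' s) (sub_eq_zero.1 h2)
  · -- Exchanging the `j`-th argument and the last one changes `⟨D(s), t⟩` by an exact operator.
    set R := Δ - pairLast n F V m D with hR
    let e : Fin 2 ↪ Fin (m + 1) := ⟨![j.castSucc, Fin.last m], by
      intro a b
      fin_cases a <;> fin_cases b <;> simp [Fin.ext_iff, j.2.ne, j.2.ne']⟩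
    refine ⟨restrictArgs e (Fin.snoc s 0) (R.domDomCongr (Equiv.swap j.castSucc (Fin.last m)) - R),
      restrictArgs_mem_exactOp (sub_mem (domDomCongr_mem_exactOp hE _) hE) _ _, fun a b => ?_⟩
    have h1 : Function.extend e ![a, b] (Fin.snoc s 0 : Fin (m + 1) → Sections n F V) =
        Fin.snoc (Function.update s j a) b := by
      funext i
      refine Fin.lastCases ?_ (fun i => ?_) i
      · rw [Fin.snoc_last]
        exact e.injective.extend_apply ![a, b] _ 1
      · rw [Fin.snoc_castSucc]
        rcases eq_or_ne i j with rfl | hij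
        · rw [Function.update_self]
          exact e.injective.extend_apply ![a, b] _ 0
        · rw [Function.update_of_ne hij, Function.extend_apply', Fin.snoc_castSucc]
          rintro ⟨c, hc⟩
          fin_cases c
          · exact hij (Fin.castSucc_injective m hc).symm
          · exact (Fin.castSucc_lt_last i).ne hc.symm
    have h2 := snoc_comp_swap (Function.update s j a) b j
    rw [Function.update_idem, Function.update_self] at h2
    rw [restrictArgs_apply, h1]
    change pairing (D (Function.update s j a)) b - pairing (D (Function.update s j b)) a =
      (Δ ((Fin.snoc (Function.update s j a) b : Fin (m + 1) → Sections n F V) ∘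
          Equiv.swap j.castSucc (Fin.last m)) -
        pairLast n F V m D ((Fin.snoc (Function.update s j a) b : Fin (m + 1) → Sections n F V) ∘
          Equiv.swap j.castSucc (Fin.last m))) -
      (Δ (Fin.snoc (Function.update s j a) b) -
        pairLast n F V m D (Fin.snoc (Function.update s j a) b))
    rw [hΔ, h2, pairLast_snoc, pairLast_snoc]
    abel

omit [FiniteDimensional ℝ F] [ContMDiffVectorBundle ∞ F V (𝓡 n)] in
/-- If `D` is symmetric, and formally self-adjoint in each argument, then
`⟨D(s₁, …, s_m), s_{m+1}⟩` is symmetric up to exact operators. -/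
theorem domDomCongr_pairLast_sub_mem_exactOp
    {D : MultilinearMap ℝ (fun _ : Fin m => Sections n F V) (ConjSections n F V)}
    (hD : D ∈ selfAdjointOp n F V m) (σ : Equiv.Perm (Fin (m + 1))) :
    (pairLast n F V m D).domDomCongr σ - pairLast n F V m D ∈ exactOp n F V (m + 1) n := by
  have hmem := pairLast_mem hD.1.1
  obtain ⟨j, τ, rfl⟩ := exists_eq_swap_mul_extendLast σ
  have hτ : (pairLast n F V m D).domDomCongr (Equiv.swap j (Fin.last m) * extendLast τ) =
      (pairLast n F V m D).domDomCongr (Equiv.swap j (Fin.last m)) := by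
    refine MultilinearMap.ext fun v => ?_
    change pairLast n F V m D ((v ∘ Equiv.swap j (Fin.last m)) ∘ extendLast τ) =
      pairLast n F V m D (v ∘ Equiv.swap j (Fin.last m))
    obtain ⟨s, t, h⟩ : ∃ s t, v ∘ Equiv.swap j (Fin.last m) = Fin.snoc s t :=
      ⟨Fin.init (v ∘ Equiv.swap j (Fin.last m)), (v ∘ Equiv.swap j (Fin.last m)) (Fin.last m),
        by simp only [Fin.snoc_init_self]⟩
    rw [h, snoc_comp_extendLast, pairLast_snoc, pairLast_snoc, hD.1.2]
  rw [hτ]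
  revert j
  refine Fin.lastCases (fun _ => ?_) fun j _ => ?_
  · rw [Equiv.swap_self]
    exact (sub_self (pairLast n F V m D)).symm ▸ zero_mem _
  · -- For fixed `s₁, …, s_m` the difference is the one in Green's formula.
    refine mem_exactOp_of_curryRight (sub_mem (domDomCongr_mem _ hmem) hmem) fun s => ?_
    obtain ⟨E, hE, h⟩ := hD.2 s j
    have h1 : ((pairLast n F V m D).domDomCongr (Equiv.swap j.castSucc (Fin.last m)) -
        pairLast n F V m D).curryRight s = E.toLinearMap ![0, s j] 0 := by
      refine LinearMap.ext fun t => ?_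
      change pairLast n F V m D ((Fin.snoc s t : Fin (m + 1) → Sections n F V) ∘
          Equiv.swap j.castSucc (Fin.last m)) - pairLast n F V m D (Fin.snoc s t) =
        E (Function.update ![0, s j] 0 t)
      have h2 : Function.update ![0, s j] 0 t = ![t, s j] := by
        funext c
        fin_cases c <;> rfl
      have h3 := h t (s j)
      rw [MultilinearMap.toLinearMap_apply, MultilinearMap.toLinearMap_apply,
        Function.update_eq_self] at h3
      rw [snoc_comp_swap, pairLast_snoc, pairLast_snoc, h2, h3]
    rw [h1]
    exact toLinearMap_mem_exactLin hE _ _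

end PairLast

/-! ### The cohomology in top degree -/

section Cohomology

variable {n : ℕ} {X : Type*} [TopologicalSpace X] [T2Space X] [SigmaCompactSpace X]
  [ChartedSpace (Model n) X] [IsManifold (𝓡 n) ∞ X]
  (F : Type*) [NormedAddCommGroup F] [NormedSpace ℝ F]
  (V : X → Type*) [TopologicalSpace (Bundle.TotalSpace F V)] [∀ x, AddCommGroup (V x)]
  [∀ x, Module ℝ (V x)] [∀ x, TopologicalSpace (V x)] [FiberBundle F V] [VectorBundle ℝ F V]

/-- The cohomology vanishes in degrees `< n`. -/
theorem subsingleton_symCohomology (m : ℕ) {i : ℕ} (hi : i < n) :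
    Subsingleton (symCohomology n F V (m + 1) i) := by
  rw [Submodule.Quotient.subsingleton_iff, eq_top_iff]
  rintro Δ -
  refine mem_symCoboundaries_iff (Δ := Δ.1).2 ?_
  obtain ⟨E, hE, -, h⟩ := exists_exactOp_hasOrderLT_sub hi.le Δ.1.2.1 fun s =>
    congrArg (fun D : SymOp n F V (m + 1) (i + 1) => D.1 s) Δ.2
  rw [h hi]
  exact hE

omit [T2Space X] [SigmaCompactSpace X] in
theorem symClass_eq_iff {l i : ℕ} {Δ Δ' : LinearMap.ker (symOpD n F V l i)} :
    symClass Δ = symClass Δ' ↔ Δ.1.1 - Δ'.1.1 ∈ exactOp n F V l i := by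
  rw [symClass, symClass, Submodule.Quotient.eq]
  exact mem_symCoboundaries_iff (Δ := (Δ - Δ').1)

/-- In degree `n` every operator is a cocycle. -/
noncomputable def cocycle {l : ℕ} : SymOp n F V l n →ₗ[ℝ] LinearMap.ker (symOpD n F V l n) :=
  LinearMap.codRestrict _ LinearMap.id fun _ => Subtype.ext <| MultilinearMap.ext fun _ =>
    eq_zero_of_degree_gt (Nat.lt_succ_self n) _

/-- The map sending `D` to the class of the symmetrization of `⟨D(s₁, …, s_m), s_{m+1}⟩`. -/
noncomputable def selfAdjointToCohomology (m : ℕ) :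
    selfAdjointOp n F V m →ₗ[ℝ] symCohomology n F V (m + 1) n :=
  Submodule.mkQ _ ∘ₗ cocycle F V ∘ₗ
    LinearMap.codRestrict (symDiffOp (SmoothFun n X) (Sections n F V) (DiffForm n X n) (m + 1))
      (symmetrize _ _ (m + 1) ∘ₗ pairLast n F V m ∘ₗ (selfAdjointOp n F V m).subtype)
      fun D => symmetrize_mem_symDiffOp (pairLast_mem D.2.1.1)

/-- The classes of `D` and `Δ` correspond if and only if `Δ` is `⟨D(s₁, …, s_m), s_{m+1}⟩` up to an
exact operator; the symmetrization does not matter. -/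
theorem selfAdjointToCohomology_eq_iff {m : ℕ} {D : selfAdjointOp n F V m}
    {Δ : LinearMap.ker (symOpD n F V (m + 1) n)} :
    selfAdjointToCohomology F V m D = symClass Δ ↔
      Δ.1.1 - pairLast n F V m D.1 ∈ exactOp n F V (m + 1) n := by
  have h := symmetrize_sub_mem (domDomCongr_pairLast_sub_mem_exactOp D.2)
  rw [eq_comm]
  refine (symClass_eq_iff F V (Δ' := cocycle F V ⟨symmetrize _ _ (m + 1) (pairLast n F V m D.1),
    symmetrize_mem_symDiffOp (pairLast_mem D.2.1.1)⟩)).trans ?_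
  rw [← Submodule.add_mem_iff_left (x := Δ.1.1 - pairLast n F V m D.1) _ (neg_mem h)]
  change Δ.1.1 - symmetrize _ _ (m + 1) (pairLast n F V m D.1) ∈ _ ↔ _
  rw [neg_sub, sub_add_sub_cancel]

variable [FiniteDimensional ℝ F] [ContMDiffVectorBundle ∞ F V (𝓡 n)]

theorem bijective_selfAdjointToCohomology (m : ℕ) :
    Function.Bijective (selfAdjointToCohomology F V m (n := n)) := by
  constructor
  · rw [← LinearMap.ker_eq_bot, LinearMap.ker_eq_bot']
    intro D hD
    have h := (selfAdjointToCohomology_eq_iff F V (D := D) (Δ := 0)).1 hD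
    refine Subtype.ext (eq_zero_of_pairLast_mem_exactOp ?_)
    have h2 := neg_mem h
    rw [neg_sub] at h2
    change pairLast n F V m D.1 - 0 ∈ _ at h2
    rwa [sub_zero] at h2
  · intro c
    obtain ⟨Δ, rfl⟩ := Submodule.mkQ_surjective _ c
    obtain ⟨D, hD, hE⟩ := exists_sub_pairLast_mem_exactOp Δ.1.2.1
    exact ⟨⟨D, mem_selfAdjointOp_of_sub_mem_exactOp Δ.1.2.2 hD hE⟩,
      (selfAdjointToCohomology_eq_iff F V).2 hE⟩

/-- The isomorphism of the top cohomology with the space of self-adjoint operators. -/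
noncomputable def cohomologyEquiv (m : ℕ) :
    symCohomology n F V (m + 1) n ≃ₗ[ℝ] selfAdjointOp n F V m :=
  (LinearEquiv.ofBijective _ (bijective_selfAdjointToCohomology F V m)).symm

theorem sub_pairLast_cohomologyEquiv_mem {m : ℕ} (Δ : LinearMap.ker (symOpD n F V (m + 1) n)) :
    Δ.1.1 - pairLast n F V m (cohomologyEquiv F V m (symClass Δ)).1 ∈ exactOp n F V (m + 1) n :=
  (selfAdjointToCohomology_eq_iff F V).1
    ((LinearEquiv.ofBijective _ (bijective_selfAdjointToCohomology F V m)).apply_symm_apply _)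

theorem eq_pairing_cohomologyEquiv_add {m : ℕ} (Δ : LinearMap.ker (symOpD n F V (m + 1) n)) :
    ∃ E ∈ exactOp n F V (m + 1) n, ∀ s : Fin (m + 1) → Sections n F V,
      Δ.1.1 s = pairing ((cohomologyEquiv F V m (symClass Δ)).1 (fun j => s j.castSucc))
        (s (Fin.last m)) + E s := by
  refine ⟨_, sub_pairLast_cohomologyEquiv_mem F V Δ, fun s => ?_⟩
  have h := pairLast_snoc (cohomologyEquiv F V m (symClass Δ)).1 (Fin.init s) (s (Fin.last m))
  rw [Fin.snoc_init_self] at h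
  change _ = pairing ((cohomologyEquiv F V m (symClass Δ)).1 (Fin.init s)) _ + (_ - _)
  rw [← h, add_sub_cancel]

omit [T2Space X] [SigmaCompactSpace X] [FiniteDimensional ℝ F]
  [ContMDiffVectorBundle ∞ F V (𝓡 n)] in
theorem selfAdjointOp_zero : selfAdjointOp n F V 0 = ⊤ :=
  eq_top_iff.2 fun D _ => ⟨⟨⟨0, fun _ i => i.elim0⟩, fun σ s => by
    rw [Subsingleton.elim (s ∘ σ) s]⟩, fun _ i => i.elim0⟩

/-- For linear operators, the top cohomology is `Γ(α̂)`: for `m = 0` the operators with values in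
`Γ(α̂)` have no arguments, and the condition of self-adjointness is empty. -/
noncomputable def linearCohomologyEquiv : symCohomology n F V 1 n ≃ₗ[ℝ] ConjSections n F V :=
  cohomologyEquiv F V 0 ≪≫ₗ LinearEquiv.ofTop _ (selfAdjointOp_zero F V) ≪≫ₗ
    (MultilinearMap.constLinearEquivOfIsEmpty (R := ℝ) (S := ℝ)
      (M₁ := fun _ : Fin 0 => Sections n F V) (M₂ := ConjSections n F V)).symm

theorem eq_pairing_linearCohomologyEquiv_add (Δ : LinearMap.ker (symOpD n F V 1 n)) :
    ∃ E ∈ exactOp n F V 1 n, ∀ s : Fin 1 → Sections n F V,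
      Δ.1.1 s = pairing (linearCohomologyEquiv F V (symClass Δ)) (s 0) + E s := by
  obtain ⟨E, hE, h⟩ := eq_pairing_cohomologyEquiv_add F V Δ
  refine ⟨E, hE, fun s => ?_⟩
  rw [h s]
  have h2 : (cohomologyEquiv F V 0 (symClass Δ)).1 (fun j => s j.castSucc) =
      linearCohomologyEquiv F V (symClass Δ) :=
    congrArg (cohomologyEquiv F V 0 (symClass Δ)).1 (Subsingleton.elim _ _)
  rw [h2]
  rfl

/-- By uniqueness, right composition of operators with `f` corresponds to multiplication by `f`. -/
theorem linearCohomologyEquiv_smul (f : SmoothFun n X)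
    (Δ Δ' : LinearMap.ker (symOpD n F V 1 n))
    (h : ∀ s : Fin 1 → Sections n F V, Δ'.1.1 s = Δ.1.1 (fun j => f • s j)) :
    linearCohomologyEquiv F V (symClass Δ') = f • linearCohomologyEquiv F V (symClass Δ) := by
  obtain ⟨E, hE, h1⟩ := eq_pairing_linearCohomologyEquiv_add F V Δ
  obtain ⟨E', hE', h2⟩ := eq_pairing_linearCohomologyEquiv_add F V Δ'
  set B := linearCohomologyEquiv F V (symClass Δ)
  set B' := linearCohomologyEquiv F V (symClass Δ')
  -- `⟨B' - f B, s⟩ = E(f s) - E'(s)` is exact.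
  have h3 : pairingₗ n F V (B' - f • B) = E.curryRight Fin.elim0 ∘ₗ
      Algebra.lsmul ℝ ℝ (Sections n F V) f - E'.curryRight Fin.elim0 := by
    refine LinearMap.ext fun t => ?_
    have h4 : ∀ (G : MultilinearMap ℝ (fun _ : Fin 1 => Sections n F V) (DiffForm n X n))
        (t : Sections n F V), G.curryRight Fin.elim0 t = G fun _ => t := fun G t =>
      congrArg G (funext fun j => by
        rw [Subsingleton.elim (α := Fin 1) j (Fin.last 0)]; exact Fin.snoc_last _ _)
    have h5 := h fun _ => t
    rw [h1, h2] at h5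
    have h6 : pairing B (f • t) = f • pairing B t := (hasOrderLT_pairing B).map_smul f t
    change pairing B' t - f • pairing B t = E.curryRight Fin.elim0 (f • t) - E'.curryRight Fin.elim0 t
    rw [h4, h4, ← h6, sub_eq_sub_iff_add_eq_add, h5, add_comm]
  have h7 : pairingₗ n F V (B' - f • B) = 0 :=
    eq_zero_of_mem_exactLin (by
      rw [h3]
      exact sub_mem (exactLin_comp (curryRight_mem_exactLin hE _) (hasOrderLT_one_lsmul f))
        (curryRight_mem_exactLin hE' _)) (hasOrderLT_pairing _)
  refine sub_eq_zero.1 (ConjSections.ext_pairing fun t => ?_)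
  exact LinearMap.congr_fun h7 t

end Cohomology

end DiffOpCohomology

/-- For a smooth vector bundle `α` (fibres `V x`) over a smooth `n`-manifold `X` and every `l > 0`
(written `m + 1`), the cohomology of `Sym^l D(α, Λ^•_X)` vanishes in degrees `i < n`, and in degree
`n` it is canonically `Sym^{l-1}_self D(α, α̂)`: the class of `Δ` corresponds to the operator `∇`
such that `Δ(s₁, …, s_l) = ⟨∇(s₁, …, s_{l-1}), s_l⟩` up to an operator of the form `d ∘ G`.
For `l = 1` it is `Γ(α̂)`, as a module over `C^∞(X)` acting on operators by right composition. -/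
theorem mainTheorem3 {n : ℕ} {X : Type*} [TopologicalSpace X] [T2Space X] [SigmaCompactSpace X]
    [ChartedSpace (EuclideanSpace ℝ (Fin n)) X] [IsManifold (𝓡 n) ∞ X]
    (F : Type*) [NormedAddCommGroup F] [NormedSpace ℝ F] [FiniteDimensional ℝ F]
    (V : X → Type*) [TopologicalSpace (Bundle.TotalSpace F V)] [∀ x, AddCommGroup (V x)]
    [∀ x, Module ℝ (V x)] [∀ x, TopologicalSpace (V x)] [FiberBundle F V] [VectorBundle ℝ F V]
    [ContMDiffVectorBundle ∞ F V (𝓡 n)] :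
    (∀ m i : ℕ, i < n → Subsingleton (symCohomology n F V (m + 1) i)) ∧
    (∀ m : ℕ, ∃ Φ : symCohomology n F V (m + 1) n ≃ₗ[ℝ] selfAdjointOp n F V m,
      ∀ Δ : LinearMap.ker (symOpD n F V (m + 1) n), ∃ E ∈ exactOp n F V (m + 1) n,
        ∀ s : Fin (m + 1) → Sections n F V,
          Δ.1.1 s =
            pairing ((Φ (symClass Δ)).1 (fun j => s j.castSucc)) (s (Fin.last m)) + E s) ∧
    (∃ Ψ : symCohomology n F V 1 n ≃ₗ[ℝ] ConjSections n F V,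
      (∀ Δ : LinearMap.ker (symOpD n F V 1 n), ∃ E ∈ exactOp n F V 1 n,
        ∀ s : Fin 1 → Sections n F V, Δ.1.1 s = pairing (Ψ (symClass Δ)) (s 0) + E s) ∧
      ∀ (f : SmoothFun n X) (Δ Δ' : LinearMap.ker (symOpD n F V 1 n)),
        (∀ s : Fin 1 → Sections n F V, Δ'.1.1 s = Δ.1.1 (fun j => f • s j)) →
          Ψ (symClass Δ') = f • Ψ (symClass Δ)) := by
  exact ⟨fun m i hi => subsingleton_symCohomology F V m hi,
    fun m => ⟨cohomologyEquiv F V m, eq_pairing_cohomologyEquiv_add F V⟩,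
    linearCohomologyEquiv F V, eq_pairing_linearCohomologyEquiv_add F V,
    linearCohomologyEquiv_smul F V⟩
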